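/- Throughout, a \emph{multiset} over a set $X$ is a function $A:X\to\mathbb N$ (possibly with infinite support), with cardinality $|A|=\sum_{x\in X}A(x)$; for $f:X\to Y$, $f(A)(y)=\sum_{f(x)=y}A(x)$. A \emph{net} is a tuple $N=(S,T,F,M_0)$ with $S,T$ disjoint sets (places, transitions), $F:(S\times T)\cup(T\times S)\to\mathbb N$ and $M_0:S\to\mathbb N$, such that for every $t\in T$ the set $\{s\mid F(s,t)>0\}$ is finite and non-empty and $\{s\mid F(t,s)>0\}$ is finite. Write ${}^\bullet x(y)=F(y,x)$, $x^\bullet(y)=F(x,y)$, extended additively to multisets of transitions. For $M,M'\in\mathbb N^S$ and a finite non-empty multiset $G$ over $T$, write $M\xrightarrow{G}M'$ if ${}^\bullet G\subseteq M$ and $M'=(M-{}^\bullet G)+G^\bullet$; write $M\xrightarrow{G}$ if such an $M'$ exists. A marking is \emph{reachable} if it is obtained from $M_0$ by firing a finite (possibly empty) sequence of single transitions. $N$ is \emph{conflict-free} if there are no reachable $M$ and finite non-empty multiset $G$ over $T$ such that $M\xrightarrow{G}$ fails while $M\xrightarrow{G\upharpoonright\{t\}}$ for every $t\in G$. $N$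 is a \emph{structural conflict net} if for all $t,u\in T$ (possibly equal) and all reachable $M$ with $M\xrightarrow{\{t,u\}}$ one has ${}^\bullet t\cap{}^\bullet u=\emptyset$. A \emph{GR-process} of $N$ is a pair $P=(\mathcal N,\pi)$ of a net $\mathcal N=(\mathcal S,\mathcal T,\mathcal F,\mathcal M_0)$ and a map $\pi:\mathcal S\cup\mathcal T\to S\cup T$ with $\pi(\mathcal S)\subseteq S$, $\pi(\mathcal T)\subseteq T$, such that: each $s\in\mathcal S$ has $|{}^\bullet s|\le1$, $|s^\bullet|\le 1$, and $\mathcal M_0(s)=1$ if ${}^\bullet s=\emptyset$, $\mathcal M_0(s)=0$ otherwise; the transitive closure $\mathcal F^+$ of $\{(x,y)\mid\mathcal F(x,y)>0\}$ is irreflexive; $\{t\in\mathcal T\mid (t,u)\in\mathcal F^+\}$ is finite for every $u\in\mathcal T$; $\pi(\mathcal M_0)=M_0$; and $\pi({}^\bullet t)={}^\bullet\pi(t)$, $\pi(t^\bullet)=\pi(t)^\bullet$ for every $t\in\mathcal T$. It is \emph{finite} if $\mathcal T$ is finite. $P'$ is a \emph{prefix} of $P$ ($P'\le P$; $P$ is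 an \emph{extension} of $P'$) if $\mathcal S'\subseteq\mathcal S$, $\mathcal T'\subseteq\mathcal T$, $\mathcal M_0'=\mathcal M_0$ as multisets, and $\mathcal F'$, $\pi'$ are the restrictions of $\mathcal F$, $\pi$. $P$ is \emph{maximal} if it has no proper extension. Isomorphism $\cong$ of processes is isomorphism of the nets (bijections on places and on transitions preserving arc weights and initial marking) respecting $\pi$. For places $p,q\in\mathcal S$ with $\pi(p)=\pi(q)$ and $(p,q),(q,p)\notin\mathcal F^+$, $\mathrm{swap}(P,p,q)$ is obtained from $P$ by exchanging the arcs leaving $p$ with those leaving $q$. Write $P\equiv_1Q$ if $\mathrm{swap}(P,p,q)\cong Q$ for some such $p,q$, and $\equiv_1^*$ for the reflexive transitive closure of $\equiv_1$. Write $P\equiv_1^\infty Q$ if for every finite prefix $P''\le P$ there are $Q'\equiv_1^*Q$ and $Q''\le Q'$ with $P''\cong Q''$, and the same holds with $P$ and $Q$ exchanged. A \emph{BD-process} of $N$ is an $\equiv_1^\infty$-class (\emph{swapping class}) of GR-processes of $N$. Write $P\sqsubseteq_1^\infty Q$ if for every finite prefix $P''\le P$ there are finite GR-processes $P',Q'$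 of $N$ with $P''\le P'\equiv_1^*Q'\le Q$. A BD-process $B$ is \emph{largest} if for every BD-process $C$ and all $P\in C$, $Q\in B$ one has $P\sqsubseteq_1^\infty Q$. \textbf{Theorem.} Every conflict-free structural conflict net $N$ has a largest BD-process. In fact, for every maximal GR-process $P$ of $N$, the swapping class of $P$ is the largest BD-process of $N$. -/

import Mathlib

universe u

/-! ### Multisets (functions into `ℕ`, possibly with infinite support) -/

/-- The cardinality `∑ x, A x ∈ ℕ ∪ {∞}` of a multiset `A : X → ℕ`: the supremum of the
finite partial sums. -/
noncomputable def mcard {X : Type u} (A : X → ℕ) : ℕ∞ :=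
  ⨆ s : Finset X, ((∑ x ∈ s, A x : ℕ) : ℕ∞)

/-- The image multiset `f(A)`, given by `f(A)(y) = ∑_{x, f x = y} A x`, as an element of
`ℕ ∪ {∞}` (so that a claim `mmap f A y = n` with `n : ℕ` includes finiteness of the sum). -/
noncomputable def mmap {X Y : Type u} (f : X → Y) (A : X → ℕ) (y : Y) : ℕ∞ :=
  mcard (fun x : {x : X // f x = y} => A x.1)

/-! ### Place/transition systems -/

/-- A net (place/transition system with arc weights and an initial marking) of finite
synchronisation in which every transition has a preplace.  The flow relation is given by its
two parts: `pre t s` is `F(s, t)` and `post t s` is `F(t, s)`. -/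
structure PTNet where
  S : Type u
  T : Type u
  pre : T → S → ℕ
  post : T → S → ℕ
  M₀ : S → ℕ
  pre_finite : ∀ t, {s | 0 < pre t s}.Finite
  pre_nonempty : ∀ t, {s | 0 < pre t s}.Nonempty
  post_finite : ∀ t, {s | 0 < post t s}.Finite

namespace PTNet

/-- `•G`, for a finite multiset `G` of transitions. -/
def preG (N : PTNet.{u}) (G : N.T →₀ ℕ) (s : N.S) : ℕ := G.sum fun t n => n * N.pre t s

/-- `G•`, for a finite multiset `G` of transitions. -/
def postG (N : PTNet.{u}) (G : N.T →₀ ℕ) (s : N.S) : ℕ := G.sum fun t n => n * N.post t s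

/-- `G` is a step from the marking `M` to the marking `M'`.  The subtraction is that of
multisets; it never truncates, as `•G ⊆ M`. -/
def Step (N : PTNet.{u}) (M : N.S → ℕ) (G : N.T →₀ ℕ) (M' : N.S → ℕ) : Prop :=
  G ≠ 0 ∧ (∀ s, N.preG G s ≤ M s) ∧ ∀ s, M' s = (M s - N.preG G s) + N.postG G s

/-- `G` can fire in `M`. -/
def CanStep (N : PTNet.{u}) (M : N.S → ℕ) (G : N.T →₀ ℕ) : Prop := ∃ M', N.Step M G M'

/-- `M` is reachable from the initial marking by firing a word of transitions. -/
def Reachable (N : PTNet.{u}) (M : N.S → ℕ) : Prop :=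
  Relation.ReflTransGen (fun M₁ M₂ => ∃ t, N.Step M₁ (Finsupp.single t 1) M₂) N.M₀ M

/-- The finite non-empty multiset `G` is in semantic conflict in `M`: it cannot fire in `M`,
but for each `t ∈ G` its restriction to `{t}` can. -/
def InConflict (N : PTNet.{u}) (M : N.S → ℕ) (G : N.T →₀ ℕ) : Prop :=
  G ≠ 0 ∧ ¬ N.CanStep M G ∧ ∀ t ∈ G.support, N.CanStep M (Finsupp.single t (G t))

/-- Semantic conflict-freeness. -/
def ConflictFree (N : PTNet.{u}) : Prop :=
  ∀ M, N.Reachable M → ∀ G : N.T →₀ ℕ, ¬ N.InConflict M G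

/-- `N` is a structural conflict net: transitions `t`, `u` (possibly equal) that can fire in
one step `{t, u}` from a reachable marking have no common preplace. -/
def StructuralConflictNet (N : PTNet.{u}) : Prop :=
  ∀ t u M, N.Reachable M → N.CanStep M (Finsupp.single t 1 + Finsupp.single u 1) →
    ∀ s, min (N.pre t s) (N.pre u s) = 0

/-- The pairs `(x, y)` of nodes with `F(x, y) > 0`. -/
def Arc (N : PTNet.{u}) : N.S ⊕ N.T → N.S ⊕ N.T → Prop
  | Sum.inl s, Sum.inr t => 0 < N.pre t s
  | Sum.inr t, Sum.inl s => 0 < N.post t s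
  | _, _ => False

/-- The transitive closure `F⁺`. -/
def Causal (N : PTNet.{u}) : N.S ⊕ N.T → N.S ⊕ N.T → Prop := Relation.TransGen N.Arc

open Classical in
/-- The net obtained by exchanging the arcs that leave the places `p` and `q`. -/
noncomputable def swap (N : PTNet.{u}) (p q : N.S) : PTNet.{u} where
  S := N.S
  T := N.T
  pre := fun t x => if x = p then N.pre t q else if x = q then N.pre t p else N.pre t x
  post := N.post
  M₀ := N.M₀
  pre_finite := fun t => by
    refine ((N.pre_finite t).union (Set.toFinite {p, q})).subset fun x hx => ?_
    by_cases h1 : x = p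
    · exact Or.inr (Or.inl h1)
    · by_cases h2 : x = q
      · exact Or.inr (Or.inr h2)
      · left
        simpa [h1, h2] using hx
  pre_nonempty := fun t => by
    obtain ⟨x, hx⟩ := N.pre_nonempty t
    by_cases h1 : x = p
    · subst h1
      refine ⟨q, ?_⟩
      by_cases h : q = x
      · subst h; simpa using hx
      · simpa [h] using hx
    · by_cases h2 : x = q
      · subst h2
        exact ⟨p, by simpa using hx⟩
      · exact ⟨x, by simpa [h1, h2] using hx⟩
  post_finite := N.post_finite

end PTNet

/-! ### GR-processes -/

/-- A net together with a map of its places and transitions to those of `N`. -/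
structure LabelledNet (N : PTNet.{u}) where
  net : PTNet.{u}
  πS : net.S → N.S
  πT : net.T → N.T

/-- The conditions for a net with a map to `N` to be a (Goltz-Reisig) process of `N`. -/
structure LabelledNet.SatisfiesGR {N : PTNet.{u}} (P : LabelledNet N) : Prop where
  /-- `|•s| ≤ 1` -/
  card_pre_place : ∀ s, mcard (fun t => P.net.post t s) ≤ 1
  /-- `|s•| ≤ 1` -/
  card_post_place : ∀ s, mcard (fun t => P.net.pre t s) ≤ 1
  init_of_empty : ∀ s, (∀ t, P.net.post t s = 0) → P.net.M₀ s = 1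
  init_of_nonempty : ∀ s, ¬ (∀ t, P.net.post t s = 0) → P.net.M₀ s = 0
  acyclic : ∀ x, ¬ P.net.Causal x x
  finite_past : ∀ u, {t | P.net.Causal (Sum.inr t) (Sum.inr u)}.Finite
  map_init : ∀ s, mmap P.πS P.net.M₀ s = (N.M₀ s : ℕ∞)
  map_pre : ∀ t s, mmap P.πS (P.net.pre t) s = (N.pre (P.πT t) s : ℕ∞)
  map_post : ∀ t s, mmap P.πS (P.net.post t) s = (N.post (P.πT t) s : ℕ∞)

/-- `swap(P, p, q)` -/
noncomputable def LabelledNet.swap {N : PTNet.{u}} (P : LabelledNet N) (p q : P.net.S) :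
    LabelledNet N where
  net := P.net.swap p q
  πS := P.πS
  πT := P.πT

/-- Isomorphisms of labelled nets: bijections on places and transitions that preserve the
initial marking, the arc weights and the labelling. -/
structure LabelledNet.Iso {N : PTNet.{u}} (P Q : LabelledNet N) where
  φS : P.net.S ≃ Q.net.S
  φT : P.net.T ≃ Q.net.T
  map_init : ∀ s, Q.net.M₀ (φS s) = P.net.M₀ s
  map_pre : ∀ t s, Q.net.pre (φT t) (φS s) = P.net.pre t s
  map_post : ∀ t s, Q.net.post (φT t) (φS s) = P.net.post t s
  map_πS : ∀ s, Q.πS (φS s) = P.πS s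
  map_πT : ∀ t, Q.πT (φT t) = P.πT t

/-- The GR-processes of `N`. -/
def GRProcess (N : PTNet.{u}) : Type (u + 1) := {P : LabelledNet N // P.SatisfiesGR}

namespace GRProcess

variable {N : PTNet.{u}}

/-- A process is finite if it has finitely many transitions. -/
def IsFinite (P : GRProcess N) : Prop := Finite P.1.net.T

/-- An inclusion of the process `P` as a prefix of the process `Q`.  As places and transitions
form types rather than subsets of a common universe, the inclusions of places and of transitions
are injective maps, along which the initial markings agree (as multisets of places of `Q`) and
the flow relation and the labelling of `P` are the restrictions of those of `Q`. -/
structure PrefixIncl (P Q : GRProcess N) where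
  iS : P.1.net.S ↪ Q.1.net.S
  iT : P.1.net.T ↪ Q.1.net.T
  init : ∀ s, Q.1.net.M₀ (iS s) = P.1.net.M₀ s
  init_out : ∀ s, s ∉ Set.range iS → Q.1.net.M₀ s = 0
  pre : ∀ t s, Q.1.net.pre (iT t) (iS s) = P.1.net.pre t s
  post : ∀ t s, Q.1.net.post (iT t) (iS s) = P.1.net.post t s
  πS : ∀ s, Q.1.πS (iS s) = P.1.πS s
  πT : ∀ t, Q.1.πT (iT t) = P.1.πT t

/-- `P ≤ Q`: `P` is a prefix of `Q`, and `Q` an extension of `P`. -/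
def Prefix (P Q : GRProcess N) : Prop := Nonempty (PrefixIncl P Q)

/-- `P` is maximal: it has no proper extension, i.e. whenever `P` is included as a prefix in a
process `Q`, all places and transitions of `Q` belong to `P`. -/
def IsMaximal (P : GRProcess N) : Prop :=
  ∀ (Q : GRProcess N) (i : PrefixIncl P Q),
    Function.Surjective i.iS ∧ Function.Surjective i.iT

/-- `P ≅ Q` -/
def Isomorphic (P Q : GRProcess N) : Prop := Nonempty (LabelledNet.Iso P.1 Q.1)

/-- One step swapping equivalence: `Q` is isomorphic to `swap(P, p, q)` for some causally
unordered places `p`, `q` of `P` with the same label. -/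
def SwapOne (P Q : GRProcess N) : Prop :=
  ∃ p q : P.1.net.S, ¬ P.1.net.Causal (Sum.inl p) (Sum.inl q) ∧
    ¬ P.1.net.Causal (Sum.inl q) (Sum.inl p) ∧ P.1.πS p = P.1.πS q ∧
    Nonempty (LabelledNet.Iso (P.1.swap p q) Q.1)

/-- The reflexive and transitive closure of one step swapping equivalence. -/
def SwapStar (P Q : GRProcess N) : Prop := Relation.ReflTransGen SwapOne P Q

/-- Every finite prefix of `P` is isomorphic to a prefix of some process that is related to `Q`
by finitely many swaps: one of the two symmetric halves of swapping equivalence. -/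
def SwapInftyHalf (P Q : GRProcess N) : Prop :=
  ∀ P'' : GRProcess N, P''.IsFinite → Prefix P'' P →
    ∃ Q' Q'' : GRProcess N, SwapStar Q' Q ∧ Prefix Q'' Q' ∧ Isomorphic P'' Q''

/-- Swapping equivalence `P ≡₁^∞ Q`. -/
def SwapInfty (P Q : GRProcess N) : Prop := SwapInftyHalf P Q ∧ SwapInftyHalf Q P

/-- The swapping preorder `P ⊑₁^∞ Q`. -/
def SwapLe (P Q : GRProcess N) : Prop :=
  ∀ P'' : GRProcess N, P''.IsFinite → Prefix P'' P →
    ∃ P' Q' : GRProcess N, P'.IsFinite ∧ Q'.IsFinite ∧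
      Prefix P'' P' ∧ SwapStar P' Q' ∧ Prefix Q' Q

/-- The swapping class of `P`: all processes that are swapping equivalent to `P`. -/
def swapClass (P : GRProcess N) : Set (GRProcess N) := {Q | SwapInfty Q P}

end GRProcess

/-! ### BD-processes -/

/-- The BD-processes of `N`: the swapping classes of the GR-processes of `N`. -/
def BDProcess (N : PTNet.{u}) : Type (u + 1) :=
  {B : Set (GRProcess N) // ∃ P : GRProcess N, B = P.swapClass}

/-- The BD-process of a GR-process. -/
def GRProcess.toBD {N : PTNet.{u}} (P : GRProcess N) : BDProcess N := ⟨P.swapClass, P, rfl⟩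

namespace BDProcess

variable {N : PTNet.{u}}

/-- The order that `⊑₁^∞` induces on BD-processes, for all choices of representatives. -/
def Le (B C : BDProcess N) : Prop := ∀ P ∈ B.1, ∀ Q ∈ C.1, GRProcess.SwapLe P Q

/-- `B` is the largest BD-process of `N`. -/
def IsLargest (B : BDProcess N) : Prop := ∀ C : BDProcess N, C.Le B

end BDProcess

/-! Runs are tracked by Parikh vectors `y : N.T →₀ ℕ`, which count the occurrences of each
transition. In a conflict-free net an enabled transition stays enabled until it fires. Hence between
reachable vectors `y ≤ z` there is a firing word (`ConflictFree.leads_of_le`), and finite processes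
with the same Parikh vector agree up to swapping (`swapEq_of_parikh_eq`): a process is grown one
transition at a time, the choice of consumed tokens is immaterial up to swaps, and different orders
are compared by completing diamonds.

Call a process stuck if no transition can be added to it; maximal processes are stuck. The
structural conflict condition serves to show that a stuck process contains every reachable Parikh
vector (`Stuck.covers`): a transition enabled after a finite prefix and never occurring afterwards
would keep its tokens unconsumed throughout the process, so it could be added. Swaps do not touch
transitions, so this property passes to the whole swapping class.

Now let `Q` lie in the class of a stuck process and let `P''` be a finite process. Some finite
prefix `Q'` of `Q` has a Parikh vector above that of `P''`. Then `P''` extends to a `P'` with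
exactly that vector, and `P'` and `Q'` agree up to swapping, so `P'' ≤ P' ≡₁* Q' ≤ Q`
(`swapLe_of_covers`). A stuck process exists by Zorn's lemma inside the unfolding of the net
(`exists_stuck`). -/

/-! ### Cardinalities of multisets -/

theorem zero_lt_ite_iff (p : Prop) [Decidable p] : 0 < (if p then 1 else 0) ↔ p := by
  split_ifs with h <;> simp [h]

theorem mcard_ite {X : Type u} (p : X → Prop) [DecidablePred p] :
    mcard (fun x => if p x then 1 else 0) = {x | p x}.encard := by
  unfold mcard
  simp only [Finset.sum_boole, Nat.cast_id]
  apply le_antisymm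
  · refine iSup_le fun s => ?_
    rw [← Set.encard_coe_eq_coe_finsetCard]
    exact Set.encard_le_encard (by intro x; simp)
  · by_cases hf : {x | p x}.Finite
    · refine le_iSup_of_le hf.toFinset ?_
      rw [hf.encard_eq_coe_toFinset_card]
      have : {x ∈ hf.toFinset | p x} = hf.toFinset := by ext; simp
      rw [this]
    · rw [Set.Infinite.encard_eq hf]
      refine (ENat.eq_top_iff_forall_ge.2 fun n => ?_).ge
      obtain ⟨s, hs, hc⟩ := Set.Infinite.exists_subset_card_eq hf n
      refine le_iSup_of_le s ?_
      have : {x ∈ s | p x} = s := by ext x; simpa using fun hx => hs hx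
      rw [this, hc]

theorem mmap_ite {X Y : Type u} (f : X → Y) (p : X → Prop) [DecidablePred p] (y : Y) :
    mmap f (fun x => if p x then 1 else 0) y = {x | p x ∧ f x = y}.encard := by
  unfold mmap
  rw [mcard_ite (fun x : {x : X // f x = y} => p x.1),
    ← Subtype.val_injective.encard_image]
  congr 1
  ext x
  simp [and_comm]

theorem le_mcard {X : Type u} (A : X → ℕ) (s : Finset X) : ((∑ x ∈ s, A x : ℕ) : ℕ∞) ≤ mcard A :=
  le_iSup (fun s : Finset X => ((∑ x ∈ s, A x : ℕ) : ℕ∞)) s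

theorem le_one_of_mcard_le_one {X : Type u} {A : X → ℕ} (h : mcard A ≤ 1) (x : X) : A x ≤ 1 := by
  have := (le_mcard A {x}).trans h
  simpa using this

theorem eq_of_mcard_le_one {X : Type u} {A : X → ℕ} (h : mcard A ≤ 1) {x y : X}
    (hx : 0 < A x) (hy : 0 < A y) : x = y := by
  classical
  by_contra hne
  have := (le_mcard A {x, y}).trans h
  rw [Finset.sum_pair hne] at this
  have : A x + A y ≤ 1 := by exact_mod_cast this
  omega

/-! ### Processes given by producers and consumers of tokens -/

/-- A process in which every place records the transition that produces it and the transition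
that consumes it. -/
structure TokProc (N : PTNet.{u}) where
  S : Type u
  T : Type u
  prod : S → Option T
  cons : S → Option T
  πS : S → N.S
  πT : T → N.T
  init_card : ∀ x, {s | prod s = none ∧ πS s = x}.encard = (N.M₀ x : ℕ∞)
  pre_card : ∀ t x, {s | cons s = some t ∧ πS s = x}.encard = (N.pre (πT t) x : ℕ∞)
  post_card : ∀ t x, {s | prod s = some t ∧ πS s = x}.encard = (N.post (πT t) x : ℕ∞)
  wf : WellFounded fun p q => ∃ e, cons p = some e ∧ prod q = some e

theorem finite_of_encard_fiber {X Y : Type u} {p : X → Prop} {f : X → Y} {c : Y → ℕ}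
    (h : ∀ y, {x | p x ∧ f x = y}.encard = (c y : ℕ∞)) (hc : {y | 0 < c y}.Finite) :
    {x | p x}.Finite := by
  refine (hc.biUnion fun y _ => Set.finite_of_encard_eq_coe (h y)).subset fun x hx => ?_
  simp only [Set.mem_iUnion, Set.mem_ofPred_eq, exists_prop]
  refine ⟨f x, ?_, hx, rfl⟩
  by_contra h0
  have h1 := h (f x)
  rw [show c (f x) = 0 by omega, Nat.cast_zero, Set.encard_eq_zero] at h1
  exact h1.le ⟨hx, rfl⟩

namespace TokProc
variable {N : PTNet.{u}}

/-- `p` is consumed by the producer of `q`. -/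
def lt (P : TokProc N) (p q : P.S) : Prop := ∃ e, P.cons p = some e ∧ P.prod q = some e

/-- `t` produces a place consumed by `u`. -/
def elt (P : TokProc N) (t u : P.T) : Prop := ∃ s, P.prod s = some t ∧ P.cons s = some u

theorem pre_finite (P : TokProc N) (t : P.T) : {s | P.cons s = some t}.Finite :=
  finite_of_encard_fiber (P.pre_card t) (N.pre_finite _)

theorem post_finite (P : TokProc N) (t : P.T) : {s | P.prod s = some t}.Finite :=
  finite_of_encard_fiber (P.post_card t) (N.post_finite _)

theorem pre_nonempty (P : TokProc N) (t : P.T) : ∃ s, P.cons s = some t := by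
  obtain ⟨x, hx⟩ := N.pre_nonempty (P.πT t)
  by_contra! h
  have h1 := P.pre_card t x
  have : {s | P.cons s = some t ∧ P.πS s = x} = ∅ := by
    ext s; simp [h s]
  rw [this, Set.encard_empty] at h1
  have : N.pre (P.πT t) x = 0 := by exact_mod_cast h1.symm
  simp only [Set.mem_ofPred_eq] at hx
  omega

theorem elt_wf (P : TokProc N) : WellFounded P.elt := by
  have key : ∀ q, ∀ e, P.prod q = some e → Acc P.elt e := by
    intro q
    induction q using P.wf.induction with
    | _ q ih =>
      intro e he
      exact ⟨_, fun t ⟨s, hs, hs'⟩ => ih s ⟨e, hs', he⟩ t hs⟩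
  exact ⟨fun e => ⟨_, fun t ⟨s, hs, _⟩ => key s t hs⟩⟩

/-- A transition has finitely many immediate predecessors, each with a finite past by induction.
Thus well-foundedness of the token order yields both acyclicity and finite pasts. -/
theorem past_finite (P : TokProc N) (e : P.T) : {t | Relation.TransGen P.elt t e}.Finite := by
  induction e using P.elt_wf.induction with
  | _ e ih =>
    have h1 : {t | P.elt t e}.Finite := by
      have : {t | P.elt t e} ⊆ ⋃ s ∈ {s | P.cons s = some e}, {t | P.prod s = some t} := by
        rintro t ⟨s, hs, hs'⟩
        simp only [Set.mem_iUnion]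
        exact ⟨s, hs', hs⟩
      refine ((P.pre_finite e).biUnion fun s _ => ?_).subset this
      exact Set.Subsingleton.finite fun a ha b hb => by
        simp only [Set.mem_ofPred_eq] at ha hb
        simpa [ha] using hb
    refine (h1.union (h1.biUnion ih)).subset fun t ht => ?_
    rcases Relation.TransGen.tail'_iff.1 ht with ⟨c, hc, hce⟩
    rcases Relation.reflTransGen_iff_eq_or_transGen.1 hc with h | h
    · exact Or.inl (h ▸ hce)
    · exact Or.inr (Set.mem_biUnion (x := c) hce h)

open Classical in
/-- The net underlying a process. -/
noncomputable abbrev net (P : TokProc N) : PTNet.{u} where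
  S := P.S
  T := P.T
  pre t s := if P.cons s = some t then 1 else 0
  post t s := if P.prod s = some t then 1 else 0
  M₀ s := if P.prod s = none then 1 else 0
  pre_finite t := by simpa only [zero_lt_ite_iff] using P.pre_finite t
  pre_nonempty t := by
    obtain ⟨s, hs⟩ := P.pre_nonempty t
    exact ⟨s, by simp [hs]⟩
  post_finite t := by simpa only [zero_lt_ite_iff] using P.post_finite t

noncomputable abbrev toLabelled (P : TokProc N) : LabelledNet N := ⟨P.net, P.πS, P.πT⟩

theorem arc_inl_inr (P : TokProc N) (s : P.S) (t : P.T) :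
    P.net.Arc (Sum.inl s) (Sum.inr t) ↔ P.cons s = some t := by
  simp only [PTNet.Arc, zero_lt_ite_iff]

theorem arc_inr_inl (P : TokProc N) (s : P.S) (t : P.T) :
    P.net.Arc (Sum.inr t) (Sum.inl s) ↔ P.prod s = some t := by
  simp only [PTNet.Arc, zero_lt_ite_iff]

theorem arc_wf (P : TokProc N) : WellFounded P.net.Arc := by
  have key : ∀ q : P.S, Acc P.net.Arc (Sum.inl q) := by
    intro q
    induction q using P.wf.induction with
    | _ q ih =>
      refine ⟨_, ?_⟩
      rintro (s | t) h
      · exact h.elim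
      · refine ⟨_, ?_⟩
        rintro (s | t') h'
        · exact ih s ⟨t, (P.arc_inl_inr s t).1 h', (P.arc_inr_inl q t).1 h⟩
        · exact h'.elim
  refine ⟨?_⟩
  rintro (s | t)
  · exact key s
  · refine ⟨_, ?_⟩
    rintro (s | t') h
    · exact key s
    · exact h.elim

theorem causal_inr_inr (P : TokProc N) {t u : P.T}
    (h : P.net.Causal (Sum.inr t) (Sum.inr u)) : Relation.TransGen P.elt t u := by
  have key : ∀ x, P.net.Causal (Sum.inr t) x →
      (∀ u, x = Sum.inr u → Relation.TransGen P.elt t u) ∧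
      (∀ s, x = Sum.inl s → ∃ u, Relation.ReflTransGen P.elt t u ∧ P.prod s = some u) := by
    intro x hx
    induction hx with
    | single h =>
      refine ⟨?_, ?_⟩
      · rintro u rfl; exact h.elim
      · rintro s rfl; exact ⟨t, .refl, (P.arc_inr_inl s t).1 h⟩
    | @tail b c _ h ih =>
      refine ⟨?_, ?_⟩
      · rintro u rfl
        rcases b with s | t'
        · obtain ⟨v, hv, hs⟩ := ih.2 s rfl
          exact Relation.TransGen.tail' hv ⟨s, hs, (P.arc_inl_inr s u).1 h⟩
        · exact h.elim
      · rintro s rfl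
        rcases b with s' | t'
        · exact h.elim
        · exact ⟨t', (ih.1 t' rfl).to_reflTransGen, (P.arc_inr_inl s t').1 h⟩
  exact (key _ h).1 u rfl

theorem causal_inl_inl (P : TokProc N) {p q : P.S} :
    P.net.Causal (Sum.inl p) (Sum.inl q) ↔ Relation.TransGen P.lt p q := by
  constructor
  · intro h
    have key : ∀ x, P.net.Causal (Sum.inl p) x →
        (∀ s, x = Sum.inl s → Relation.TransGen P.lt p s) ∧
        (∀ u, x = Sum.inr u → ∃ s, Relation.ReflTransGen P.lt p s ∧ P.cons s = some u) := by
      intro x hx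
      induction hx with
      | single h =>
        refine ⟨?_, ?_⟩
        · rintro u rfl; exact h.elim
        · rintro u rfl; exact ⟨p, .refl, (P.arc_inl_inr p u).1 h⟩
      | @tail b c _ h ih =>
        refine ⟨?_, ?_⟩
        · rintro s rfl
          rcases b with s' | t'
          · exact h.elim
          · obtain ⟨v, hv, hs⟩ := ih.2 t' rfl
            exact Relation.TransGen.tail' hv ⟨t', hs, (P.arc_inr_inl s t').1 h⟩
        · rintro u rfl
          rcases b with s' | t'
          · exact ⟨s', (ih.1 s' rfl).to_reflTransGen, (P.arc_inl_inr s' u).1 h⟩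
          · exact h.elim
    exact (key _ h).1 q rfl
  · have step : ∀ a b : P.S, P.lt a b → P.net.Causal (Sum.inl a) (Sum.inl b) := by
      rintro a b ⟨e, h1, h2⟩
      exact (Relation.TransGen.single ((P.arc_inl_inr a e).2 h1)).tail ((P.arc_inr_inl b e).2 h2)
    intro h
    induction h with
    | single h => exact step _ _ h
    | tail _ h ih => exact ih.trans (step _ _ h)

open Classical in
theorem satisfiesGR (P : TokProc N) : P.toLabelled.SatisfiesGR where
  card_pre_place s := by
    refine (mcard_ite (fun t => P.prod s = some t)).trans_le ?_
    rw [Set.encard_le_one_iff]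
    intro a b ha hb
    simp only [Set.mem_ofPred_eq] at ha hb
    simpa [ha] using hb
  card_post_place s := by
    refine (mcard_ite (fun t => P.cons s = some t)).trans_le ?_
    rw [Set.encard_le_one_iff]
    intro a b ha hb
    simp only [Set.mem_ofPred_eq] at ha hb
    simpa [ha] using hb
  init_of_empty s h := by
    have : P.prod s = none := by
      rw [Option.eq_none_iff_forall_ne_some]
      intro t ht
      simpa [ht] using h t
    simp [this]
  init_of_nonempty s h := by
    have : P.prod s ≠ none := by
      intro h0
      exact h fun t => by simp [h0]
    simp [this]
  acyclic x h := (P.arc_wf.transGen.irrefl.irrefl x h)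
  finite_past u := (P.past_finite u).subset fun _ ht => P.causal_inr_inr ht
  map_init x := (mmap_ite P.πS (fun s => P.prod s = none) x).trans (P.init_card x)
  map_pre (t : P.T) x := (mmap_ite P.πS (fun s => P.cons s = some t) x).trans (P.pre_card t x)
  map_post (t : P.T) x := (mmap_ite P.πS (fun s => P.prod s = some t) x).trans (P.post_card t x)

noncomputable abbrev toGR (P : TokProc N) : GRProcess N := ⟨P.toLabelled, P.satisfiesGR⟩

end TokProc

theorem exists_option_of_mcard_le_one {X Y : Type u} {A : X → Y → ℕ}
    (h : ∀ y, mcard (fun x => A x y) ≤ 1) :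
    ∃ f : Y → Option X, ∀ x y, (f y = some x ↔ 0 < A x y) := by
  classical
  refine ⟨fun y => if hy : ∃ x, 0 < A x y then some hy.choose else none, fun x y => ?_⟩
  by_cases hy : ∃ x, 0 < A x y
  · simp only [hy, dite_true, Option.some.injEq]
    constructor
    · rintro rfl; exact hy.choose_spec
    · intro hx; exact eq_of_mcard_le_one (h y) hy.choose_spec hx
  · simp only [hy, dite_false, reduceCtorEq, false_iff]
    exact fun hx => hy ⟨x, hx⟩

-- The bounds on `•s` and `s•` force all arc weights to be 0 or 1, so producers and consumers
-- determine the net. The conclusion is an equality rather than an isomorphism, so a GR-process can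
-- be replaced by substitution.
open Classical in
theorem TokProc.exists_toGR_eq {N : PTNet.{u}} (G : GRProcess N) : ∃ P : TokProc N, P.toGR = G := by
  obtain ⟨⟨⟨S, T, pre, post, M₀, h1, h2, h3⟩, πS, πT⟩, hG⟩ := G
  obtain ⟨pr, hpr⟩ := exists_option_of_mcard_le_one hG.card_pre_place
  obtain ⟨co, hco⟩ := exists_option_of_mcard_le_one hG.card_post_place
  dsimp only at pr hpr co hco
  have epre : pre = fun t s => if co s = some t then 1 else 0 := by
    funext t s
    have := le_one_of_mcard_le_one (hG.card_post_place s) t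
    dsimp only at this
    by_cases h : co s = some t
    · have := (hco t s).1 h
      simp only [h, if_true]; omega
    · have := mt (hco t s).2 h
      simp only [h, if_false]; omega
  have epost : post = fun t s => if pr s = some t then 1 else 0 := by
    funext t s
    have := le_one_of_mcard_le_one (hG.card_pre_place s) t
    dsimp only at this
    by_cases h : pr s = some t
    · have := (hpr t s).1 h
      simp only [h, if_true]; omega
    · have := mt (hpr t s).2 h
      simp only [h, if_false]; omega
  subst epre epost
  have eM : M₀ = fun s => if pr s = none then 1 else 0 := by
    funext s
    by_cases h : pr s = none
    · simp only [h, if_true]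
      exact hG.init_of_empty s fun t => by simp [h]
    · simp only [h, if_false]
      refine hG.init_of_nonempty s fun h' => h ?_
      rw [Option.eq_none_iff_forall_ne_some]
      intro t ht
      simpa [ht] using h' t
  subst eM
  let C : T → Set T := fun u => {t | PTNet.Causal ⟨S, T, fun t s => if co s = some t then 1 else 0,
    fun t s => if pr s = some t then 1 else 0, fun s => if pr s = none then 1 else 0, h1, h2, h3⟩
    (Sum.inr t) (Sum.inr u)}
  have hC : ∀ t u s, pr s = some t → co s = some u → (C t).ncard < (C u).ncard := by
    intro t u s ht hu
    have htu : t ∈ C u := by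
      refine (Relation.TransGen.single (b := Sum.inl s) ?_).tail ?_
      · simp [PTNet.Arc, ht]
      · simp [PTNet.Arc, hu]
    refine Set.ncard_lt_ncard ⟨fun v hv => Relation.TransGen.trans hv htu, fun h => ?_⟩
      (hG.finite_past u)
    exact hG.acyclic _ (h htu)
  refine ⟨⟨S, T, pr, co, πS, πT, fun x => ?_, fun t x => ?_, fun t x => ?_, ?_⟩, rfl⟩
  · exact (mmap_ite πS (fun s => pr s = none) x).symm.trans (hG.map_init x)
  · exact (mmap_ite πS (fun s => co s = some t) x).symm.trans (hG.map_pre t x)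
  · exact (mmap_ite πS (fun s => pr s = some t) x).symm.trans (hG.map_post t x)
  · refine Subrelation.wf (r := InvImage (· < ·) fun s => (pr s).elim 0 fun e => (C e).ncard + 1)
      ?_ (InvImage.wf _ wellFounded_lt)
    rintro p q ⟨e, hp, hq⟩
    rcases h : pr p with _ | t
    · simp [InvImage, hq, h]
    · simpa [InvImage, hq, h] using hC t e p h hp

/-! ### Counting in fibres, and isomorphisms of processes -/

theorem encard_preimage_equiv {X Y : Type u} (e : X ≃ Y) (A : Set Y) :
    (e ⁻¹' A).encard = A.encard := by
  exact Set.encard_preimage_of_bijective e.bijective A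

theorem exists_equiv_of_encard_fiber_eq {X Y Z : Type u} {f : X → Z} {g : Y → Z} {c : Z → ℕ}
    (hf : ∀ z, {x | f x = z}.encard = (c z : ℕ∞)) (hg : ∀ z, {y | g y = z}.encard = (c z : ℕ∞)) :
    ∃ e : X ≃ Y, ∀ x, g (e x) = f x := by
  have key : ∀ z, Nonempty ({x // f x = z} ≃ {y // g y = z}) := by
    intro z
    have h1 : Finite {x // f x = z} := Set.finite_of_encard_eq_coe (hf z)
    have h2 : Finite {y // g y = z} := Set.finite_of_encard_eq_coe (hg z)
    refine Finite.card_eq.1 ?_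
    have h3 : {x | f x = z}.ncard = {y | g y = z}.ncard := by
      rw [Set.ncard, Set.ncard, hf, hg]
    exact h3
  have e := fun z => (key z).some
  refine ⟨(Equiv.sigmaFiberEquiv f).symm.trans
    ((Equiv.sigmaCongrRight e).trans (Equiv.sigmaFiberEquiv g)), fun x => ?_⟩
  exact (e (f x) ⟨x, rfl⟩).2

theorem encard_sigma_fin_fiber {X : Type u} (c : X → ℕ) (x : X) :
    {z : Σ x, Fin (c x) | z.1 = x}.encard = (c x : ℕ∞) := by
  have : {z : Σ x, Fin (c x) | z.1 = x} = Set.range (Sigma.mk (β := fun x => Fin (c x)) x) := by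
    ext ⟨y, i⟩
    constructor
    · rintro rfl; exact ⟨i, rfl⟩
    · rintro ⟨j, hj⟩; exact (congrArg Sigma.fst hj).symm
  rw [this, ← Set.image_univ, sigma_mk_injective.encard_image, Set.encard_univ]
  simp

theorem encard_setOf_sum_of_inl {X Y : Type u} {p : X ⊕ Y → Prop} {q : X → Prop}
    (h₁ : ∀ x, p (Sum.inl x) ↔ q x) (h₂ : ∀ y, ¬ p (Sum.inr y)) :
    {s | p s}.encard = {x | q x}.encard := by
  rw [← Sum.inl_injective.encard_image {x | q x}]
  congr 1
  ext (s | s)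
  · simp [h₁]
  · simp [h₂]

theorem encard_setOf_sum_of_inr {X Y : Type u} {p : X ⊕ Y → Prop} {q : Y → Prop}
    (h₁ : ∀ y, p (Sum.inr y) ↔ q y) (h₂ : ∀ x, ¬ p (Sum.inl x)) :
    {s | p s}.encard = {y | q y}.encard := by
  rw [← Sum.inr_injective.encard_image {y | q y}]
  congr 1
  ext (s | s)
  · simp [h₂]
  · simp [h₁]

namespace TokProc
variable {N : PTNet.{u}}

structure Iso (P Q : TokProc N) where
  φS : P.S ≃ Q.S
  φT : P.T ≃ Q.T
  prod : ∀ s, Q.prod (φS s) = (P.prod s).map φT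
  cons : ∀ s, Q.cons (φS s) = (P.cons s).map φT
  πS : ∀ s, Q.πS (φS s) = P.πS s
  πT : ∀ t, Q.πT (φT t) = P.πT t

def Iso.refl (P : TokProc N) : Iso P P :=
  ⟨.refl _, .refl _, fun s => by simp, fun s => by simp, fun _ => rfl, fun _ => rfl⟩

def Iso.trans {P Q R : TokProc N} (i : Iso P Q) (j : Iso Q R) : Iso P R :=
  ⟨i.φS.trans j.φS, i.φT.trans j.φT, fun s => by simp [i.prod, j.prod],
    fun s => by simp [i.cons, j.cons],
    fun s => by simp [i.πS, j.πS], fun s => by simp [i.πT, j.πT]⟩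

def Iso.symm {P Q : TokProc N} (i : Iso P Q) : Iso Q P where
  φS := i.φS.symm
  φT := i.φT.symm
  prod s := by
    have := i.prod (i.φS.symm s)
    rw [Equiv.apply_symm_apply] at this
    simp [this]
  cons s := by
    have := i.cons (i.φS.symm s)
    rw [Equiv.apply_symm_apply] at this
    simp [this]
  πS s := by simpa using (i.πS (i.φS.symm s)).symm
  πT s := by simpa using (i.πT (i.φT.symm s)).symm

theorem ite_one_zero_congr {p q : Prop} [Decidable p] [Decidable q] (h : p ↔ q) :
    (if p then 1 else 0) = if q then 1 else 0 := by
  simp only [h]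

theorem map_eq_some_apply_iff {X Y : Type u} {f : X → Y} (hf : Function.Injective f)
    {o : Option X} {x : X} : o.map f = some (f x) ↔ o = some x := by
  rw [← Option.map_some, (Option.map_injective hf).eq_iff]

open Classical in
theorem Iso.toLabelled {P Q : TokProc N} (i : Iso P Q) :
    Nonempty (LabelledNet.Iso P.toLabelled Q.toLabelled) := by
  refine ⟨⟨i.φS, i.φT, fun (s : P.S) => ite_one_zero_congr ?_,
    fun (t : P.T) (s : P.S) => ite_one_zero_congr ?_,
    fun (t : P.T) (s : P.S) => ite_one_zero_congr ?_, i.πS, i.πT⟩⟩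
  · rw [i.prod, Option.map_eq_none_iff]
  · rw [i.cons, map_eq_some_apply_iff i.φT.injective]
  · rw [i.prod, map_eq_some_apply_iff i.φT.injective]

/-! ### Swapping -/

/-- `p` and `q` can be swapped: they are causally unordered and carry the same label. -/
structure Swappable (P : TokProc N) (p q : P.S) : Prop where
  not_lt : ¬ Relation.TransGen P.lt p q
  not_gt : ¬ Relation.TransGen P.lt q p
  label : P.πS p = P.πS q

-- Strictly below `p` or `q` neither of the two occurs, since they are unordered, so the swap
-- changes nothing there and both are accessible. Any other place has as new predecessors only its
-- old ones and possibly `p` or `q`.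
open Classical in
theorem Swappable.wf {P : TokProc N} {p q : P.S} (h : P.Swappable p q) :
    WellFounded fun a b => ∃ e, P.cons (Equiv.swap p q a) = some e ∧ P.prod b = some e := by
  have irr : ∀ x, ¬ Relation.TransGen P.lt x x := fun x => P.wf.transGen.irrefl.irrefl x
  have below : ∀ x, (Relation.ReflTransGen P.lt x p ∨ Relation.ReflTransGen P.lt x q) →
      Acc (fun a b => ∃ e, P.cons (Equiv.swap p q a) = some e ∧ P.prod b = some e) x := by
    intro x
    induction x using P.wf.induction with
    | _ x ih =>
      intro hx
      refine ⟨_, ?_⟩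
      rintro y ⟨e, hy, he⟩
      have hlt : P.lt (Equiv.swap p q y) x := ⟨e, hy, he⟩
      have hp : ∀ z, P.lt z x → z ≠ p ∧ z ≠ q := by
        intro z hz
        refine ⟨?_, ?_⟩ <;> rintro rfl
        · rcases hx with h' | h'
          · exact irr _ (Relation.TransGen.head' hz h')
          · exact h.not_lt (Relation.TransGen.head' hz h')
        · rcases hx with h' | h'
          · exact h.not_gt (Relation.TransGen.head' hz h')
          · exact irr _ (Relation.TransGen.head' hz h')
      have h1 := hp _ hlt
      have hyp : y ≠ p := by
        rintro rfl; simp at h1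
      have hyq : y ≠ q := by
        rintro rfl; simp at h1
      rw [Equiv.swap_apply_of_ne_of_ne hyp hyq] at hlt
      exact ih y hlt (hx.imp (Relation.ReflTransGen.head hlt) (Relation.ReflTransGen.head hlt))
  refine ⟨fun x => ?_⟩
  induction x using P.wf.induction with
  | _ x ih =>
    refine ⟨_, ?_⟩
    rintro y ⟨e, hy, he⟩
    by_cases hyp : y = p
    · exact below y (Or.inl (hyp ▸ .refl))
    by_cases hyq : y = q
    · exact below y (Or.inr (hyq ▸ .refl))
    rw [Equiv.swap_apply_of_ne_of_ne hyp hyq] at hy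
    exact ih y ⟨e, hy, he⟩

open Classical in
theorem πS_swap_apply {P : TokProc N} {p q : P.S} (h : P.πS p = P.πS q) (s : P.S) :
    P.πS (Equiv.swap p q s) = P.πS s := by
  rw [Equiv.swap_apply_def]
  split_ifs with h1 h2
  · rw [h1, h]
  · rw [h2, h]
  · rfl

open Classical in
/-- The process obtained by exchanging the consumers of `p` and `q`. -/
noncomputable abbrev swap (P : TokProc N) (p q : P.S) (h : P.Swappable p q) : TokProc N where
  S := P.S
  T := P.T
  prod := P.prod
  cons s := P.cons (Equiv.swap p q s)
  πS := P.πS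
  πT := P.πT
  init_card := P.init_card
  pre_card t x := by
    rw [← P.pre_card, ← encard_preimage_equiv (Equiv.swap p q)]
    congr 1
    ext s
    simp [πS_swap_apply h.label]
  post_card := P.post_card
  wf := h.wf

open Classical in
theorem swap_toLabelled (P : TokProc N) (p q : P.S) (h : P.Swappable p q) :
    Nonempty (LabelledNet.Iso (P.toLabelled.swap p q) (P.swap p q h).toLabelled) := by
  refine ⟨⟨Equiv.refl P.S, Equiv.refl P.T, fun s => rfl, fun (t : P.T) (s : P.S) => ?_,
    fun t s => rfl, fun _ => rfl, fun _ => rfl⟩⟩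
  change (if P.cons (Equiv.swap p q s) = some t then 1 else 0) =
    if s = p then (if P.cons q = some t then 1 else 0)
    else if s = q then (if P.cons p = some t then 1 else 0)
    else if P.cons s = some t then 1 else 0
  simp only [Equiv.swap_apply_def]
  split_ifs <;> simp_all

theorem swappable_iff (P : TokProc N) (p q : P.S) :
    P.Swappable p q ↔ ¬ P.net.Causal (Sum.inl p) (Sum.inl q) ∧
      ¬ P.net.Causal (Sum.inl q) (Sum.inl p) ∧ P.πS p = P.πS q := by
  rw [causal_inl_inl, causal_inl_inl]
  exact ⟨fun h => ⟨h.1, h.2, h.3⟩, fun h => ⟨h.1, h.2.1, h.2.2⟩⟩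

/-! ### Adding a transition -/

/-- `A` is a set of unconsumed places on which a transition labelled `t` can be put. -/
structure Addable (P : TokProc N) (t : N.T) (A : Set P.S) : Prop where
  cons_eq_none : ∀ s ∈ A, P.cons s = none
  card : ∀ x, {s | s ∈ A ∧ P.πS s = x}.encard = (N.pre t x : ℕ∞)

open Classical in
/-- The extension of `P` by one transition, labelled `t`, that consumes `A`. -/
noncomputable abbrev add (P : TokProc N) (t : N.T) (A : Set P.S) (h : P.Addable t A) : TokProc N where
  S := P.S ⊕ Σ x, Fin (N.post t x)
  T := Option P.T
  prod := Sum.elim (fun s => (P.prod s).map some) fun _ => some none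
  cons := Sum.elim (fun s => if s ∈ A then some none else (P.cons s).map some) fun _ => none
  πS := Sum.elim P.πS Sigma.fst
  πT o := o.elim t P.πT
  init_card x := (encard_setOf_sum_of_inl (by simp) (by simp)).trans (P.init_card x)
  pre_card o x := by
    rcases o with _ | e
    · refine (encard_setOf_sum_of_inl (fun s => ?_) (by simp)).trans (h.card x)
      by_cases hs : s ∈ A <;> simp [hs]
    · refine (encard_setOf_sum_of_inl (fun s => ?_) (by simp)).trans (P.pre_card e x)
      by_cases hs : s ∈ A
      · simp [hs, h.cons_eq_none s hs]
      · simp [hs]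
  post_card o x := by
    rcases o with _ | e
    · exact (encard_setOf_sum_of_inr (by simp) (by simp)).trans
        (encard_sigma_fin_fiber (N.post t) x)
    · exact (encard_setOf_sum_of_inl (by simp) (by simp)).trans (P.post_card e x)
  wf := by
    -- The new transition produces no old place, so nothing changes below an old place.
    have key : ∀ s : P.S, Acc (fun a b : P.S ⊕ Σ x, Fin (N.post t x) => ∃ e,
        Sum.elim (fun s => if s ∈ A then some none else (P.cons s).map some)
          (fun _ => none) a = some e ∧
        Sum.elim (fun s => (P.prod s).map some) (fun _ => some none) b = some e) (Sum.inl s) := by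
      intro s
      induction s using P.wf.induction with
      | _ s ih =>
        refine ⟨_, ?_⟩
        rintro (a | a) ⟨e, h1, h2⟩
        · refine ih a ?_
          by_cases ha : a ∈ A
          · simp only [Sum.elim_inl, ha, if_true, Option.some.injEq] at h1
            simp [← h1] at h2
          · simp only [Sum.elim_inl, ha, if_false, Option.map_eq_some_iff] at h1 h2
            obtain ⟨b, hb, rfl⟩ := h1
            obtain ⟨c, hc, hcb⟩ := h2
            exact ⟨b, hb, by simpa [hc] using hcb⟩
        · simp at h1
    refine ⟨?_⟩
    rintro (s | s)
    · exact key s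
    · refine ⟨_, ?_⟩
      rintro (a | a) ⟨e, h1, h2⟩
      · exact key a
      · simp at h1

theorem Addable.map {P Q : TokProc N} (i : Iso P Q) {t : N.T} {A : Set P.S}
    (h : P.Addable t A) : Q.Addable t (i.φS '' A) where
  cons_eq_none := by
    rintro _ ⟨s, hs, rfl⟩
    simp [i.cons, h.cons_eq_none s hs]
  card x := by
    rw [← h.card x, ← i.φS.injective.encard_image]
    congr 1
    ext s
    constructor
    · rintro ⟨⟨a, ha, rfl⟩, rfl⟩
      exact ⟨a, ⟨ha, (i.πS a).symm⟩, rfl⟩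
    · rintro ⟨a, ⟨ha, rfl⟩, rfl⟩
      exact ⟨⟨a, ha, rfl⟩, i.πS a⟩

noncomputable def Iso.add {P Q : TokProc N} (i : Iso P Q) {t : N.T} {A : Set P.S}
    (h : P.Addable t A) : Iso (P.add t A h) (Q.add t (i.φS '' A) (h.map i)) where
  φS := Equiv.sumCongr i.φS (Equiv.refl _)
  φT := Equiv.optionCongr i.φT
  prod := by
    rintro (s | s)
    · change Option.map some (Q.prod (i.φS s)) = _
      change _ = Option.map (Equiv.optionCongr i.φT) ((P.prod s).map some)
      rw [i.prod]
      cases P.prod s <;> rfl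
    · rfl
  cons := by
    classical
    rintro (s | s)
    · change (if i.φS s ∈ i.φS '' A then some none else Option.map some (Q.cons (i.φS s))) =
        Option.map (Equiv.optionCongr i.φT) (if s ∈ A then some none else (P.cons s).map some)
      simp only [i.cons, i.φS.injective.mem_set_image]
      split_ifs
      · rfl
      · cases P.cons s <;> rfl
    · rfl
  πS := by
    rintro (s | s)
    · exact i.πS s
    · rfl
  πT := by
    rintro (_ | t)
    · rfl
    · exact i.πT t

/-! ### Restriction to a closed set of transitions -/

def Closed (P : TokProc N) (E : Set P.T) : Prop := ∀ t u, P.elt t u → u ∈ E → t ∈ E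

open Classical in
/-- The restriction of an optional element to a subset. -/
noncomputable def clip {X : Type u} (E : Set X) (o : Option X) : Option E :=
  o.bind fun x => if h : x ∈ E then some ⟨x, h⟩ else none

theorem clip_eq_some {X : Type u} {E : Set X} {o : Option X} {e : E} :
    clip E o = some e ↔ o = some e.1 := by
  rcases o with _ | x
  · simp [clip]
  · by_cases h : x ∈ E
    · simp [clip, h, Subtype.ext_iff]
    · simp only [clip, Option.bind_some, h, dite_false, reduceCtorEq, Option.some.injEq, false_iff]
      rintro rfl; exact h e.2

theorem clip_eq_none {X : Type u} {E : Set X} {o : Option X} :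
    clip E o = none ↔ ∀ x ∈ E, o ≠ some x := by
  rw [Option.eq_none_iff_forall_ne_some]
  constructor
  · intro h x hx ho
    exact h ⟨x, hx⟩ (clip_eq_some.2 ho)
  · intro h e he
    exact h e.1 e.2 (clip_eq_some.1 he)

theorem encard_subtype_and {X : Type u} {p q : X → Prop} (h : ∀ x, q x → p x) :
    {x : {x // p x} | q x.1}.encard = {x | q x}.encard := by
  rw [← Subtype.val_injective.encard_image]
  congr 1
  ext x
  simpa using h x

/-- The prefix of `P` with the set `E` of transitions. -/
noncomputable abbrev restrict (P : TokProc N) (E : Set P.T) (hE : P.Closed E) : TokProc N where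
  S := {s : P.S // ∀ t, P.prod s = some t → t ∈ E}
  T := E
  prod s := clip E (P.prod s.1)
  cons s := clip E (P.cons s.1)
  πS s := P.πS s.1
  πT t := P.πT t.1
  init_card x := by
    rw [← P.init_card x, ← encard_subtype_and
      (p := fun s => ∀ t, P.prod s = some t → t ∈ E) (fun s hs t ht => by simp [hs.1] at ht)]
    congr 1
    ext s
    refine and_congr_left fun _ => ⟨fun h => ?_, fun h => by simp [h, clip]⟩
    rw [clip_eq_none] at h
    rw [Option.eq_none_iff_forall_ne_some]
    exact fun t ht => h t (s.2 t ht) ht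
  pre_card t x := by
    rw [← P.pre_card t.1 x, ← encard_subtype_and
      (p := fun s => ∀ t, P.prod s = some t → t ∈ E)
      (fun s hs u hu => hE u t ⟨s, hu, hs.1⟩ t.2)]
    congr 1
    ext s
    simp [clip_eq_some]
  post_card t x := by
    rw [← P.post_card t.1 x, ← encard_subtype_and
      (p := fun s => ∀ t, P.prod s = some t → t ∈ E)
      (fun s hs u hu => by
        obtain rfl : t.1 = u := by simpa [hs.1] using hu
        exact t.2)]
    congr 1
    ext s
    simp [clip_eq_some]
  wf := by
    refine Subrelation.wf ?_ (InvImage.wf Subtype.val P.wf)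
    rintro a b ⟨e, h1, h2⟩
    exact ⟨e.1, clip_eq_some.1 h1, clip_eq_some.1 h2⟩

noncomputable def restrictUniv (P : TokProc N) (hE : P.Closed Set.univ) :
    Iso (P.restrict Set.univ hE) P where
  φS := Equiv.subtypeUnivEquiv fun _ _ _ => trivial
  φT := Equiv.Set.univ _
  prod s := by
    change P.prod s.1 = Option.map (Equiv.Set.univ _) (clip _ (P.prod s.1))
    cases P.prod s.1 <;> simp [clip]
  cons s := by
    change P.cons s.1 = Option.map (Equiv.Set.univ _) (clip _ (P.cons s.1))
    cases P.cons s.1 <;> simp [clip]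
  πS _ := rfl
  πT _ := rfl

/-- Since `e ∉ E`, its pretokens are unconsumed in the restriction; `hpre` ensures that they are
present in it. -/
theorem addable_restrict (P : TokProc N) {E : Set P.T} (hE : P.Closed E) {e : P.T} (he : e ∉ E)
    (hpre : ∀ t, P.elt t e → t ∈ E) :
    (P.restrict E hE).Addable (P.πT e) {s | P.cons s.1 = some e} where
  cons_eq_none s hs := clip_eq_none.2 fun x hx h => he (by
    obtain rfl : e = x := by simpa [show P.cons s.1 = some e from hs] using h
    exact hx)
  card x := by
    rw [← P.pre_card e x, ← encard_subtype_and
      (p := fun s => ∀ t, P.prod s = some t → t ∈ E)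
      (fun s hs u hu => hpre u ⟨s, hu, hs.1⟩)]
    rfl

theorem Closed.insert {P : TokProc N} {E : Set P.T} (hE : P.Closed E) {e : P.T}
    (hpre : ∀ t, P.elt t e → t ∈ E) : P.Closed (insert e E) := by
  rintro t u htu (rfl | hu)
  · exact Or.inr (hpre t htu)
  · exact Or.inr (hE t u htu hu)

theorem restrict_insert (P : TokProc N) {E : Set P.T} (hE : P.Closed E) {e : P.T} (he : e ∉ E)
    (hpre : ∀ t, P.elt t e → t ∈ E) (hE' : P.Closed (insert e E)) :
    Nonempty (Iso ((P.restrict E hE).add _ _ (P.addable_restrict hE he hpre))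
      (P.restrict (insert e E) hE')) := by
  -- `add` creates numbered tokens; `ε` matches them, label by label, with the tokens that `e`
  -- produces in `P`.
  obtain ⟨ε, hε⟩ := exists_equiv_of_encard_fiber_eq
    (f := fun z : Σ x, Fin (N.post (P.πT e) x) => z.1)
    (g := fun s : {s // P.prod s = some e} => P.πS s.1) (c := N.post (P.πT e))
    (encard_sigma_fin_fiber _) (fun x => by
      rw [← P.post_card e x, ← encard_subtype_and (p := fun s => P.prod s = some e)
        fun s hs => hs.1]
      congr 1
      ext s
      simp [s.2])
  let fS : ((P.restrict E hE).add _ _ (P.addable_restrict hE he hpre)).S →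
      (P.restrict (insert e E) hE').S :=
    Sum.elim (fun s => ⟨s.1, fun t ht => Or.inr (s.2 t ht)⟩)
      (fun z => ⟨(ε z).1, fun t ht => Or.inl (by simpa [(ε z).2] using ht.symm)⟩)
  let fT : Option E → (insert e E : Set P.T) :=
    fun o => o.elim ⟨e, Or.inl rfl⟩ fun t => ⟨t.1, Or.inr t.2⟩
  have hfS : Function.Bijective fS := by
    constructor
    · rintro (a | a) (b | b) hab <;> replace hab := congrArg Subtype.val hab
      · exact congrArg Sum.inl (Subtype.ext hab)
      · exact (he (a.2 e ((congrArg P.prod hab).trans (ε b).2))).elim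
      · exact (he (b.2 e ((congrArg P.prod hab.symm).trans (ε a).2))).elim
      · exact congrArg Sum.inr (ε.injective (Subtype.ext hab))
    · rintro ⟨s, hs⟩
      by_cases h : P.prod s = some e
      · refine ⟨Sum.inr (ε.symm ⟨s, h⟩), ?_⟩
        exact Subtype.ext (congrArg (fun z => z.1) (ε.apply_symm_apply ⟨s, h⟩))
      · refine ⟨Sum.inl ⟨s, fun t ht => ?_⟩, rfl⟩
        rcases hs t ht with rfl | h'
        · exact (h ht).elim
        · exact h'
  have hfT : Function.Bijective fT := by
    constructor
    · rintro (_ | a) (_ | b) hab <;> replace hab := congrArg Subtype.val hab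
      · rfl
      · exact (he ((show e = b.1 from hab) ▸ b.2)).elim
      · exact (he ((show a.1 = e from hab) ▸ a.2)).elim
      · exact congrArg some (Subtype.ext hab)
    · rintro ⟨t, rfl | ht⟩
      · exact ⟨none, rfl⟩
      · exact ⟨some ⟨t, ht⟩, rfl⟩
  have hclip : ∀ o : Option P.T, o ≠ some e →
      clip (insert e E) o = ((clip E o).map some).map fT := by
    intro o ho
    rcases o with _ | t
    · simp [clip]
    · have hte : t ≠ e := fun h => ho (by rw [h])
      by_cases h : t ∈ E <;> simp [clip, h, hte, fT]
  refine ⟨⟨Equiv.ofBijective fS hfS, Equiv.ofBijective fT hfT, ?_, ?_, ?_, ?_⟩⟩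
  · rintro (s | z)
    · exact hclip (P.prod s.1) fun h => he (s.2 e h)
    · change clip (insert e E) (P.prod (ε z).1) = some (fT none)
      rw [clip_eq_some]
      exact (ε z).2
  · rintro (s | z)
    · by_cases h : P.cons s.1 = some e
      · have : ((P.restrict E hE).add _ _ (P.addable_restrict hE he hpre)).cons (Sum.inl s)
            = some none := if_pos h
        rw [this]
        exact clip_eq_some.2 h
      · have : ((P.restrict E hE).add _ _ (P.addable_restrict hE he hpre)).cons (Sum.inl s)
            = (clip E (P.cons s.1)).map some := if_neg h
        rw [this]
        exact hclip _ h
    · change clip (insert e E) (P.cons (ε z).1) = none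
      rw [clip_eq_none]
      rintro t (rfl | ht) hc
      · exact P.wf.irrefl.irrefl (ε z).1 ⟨t, hc, (ε z).2⟩
      · exact he (hE e t ⟨_, (ε z).2, hc⟩ ht)
  · rintro (s | z)
    · rfl
    · exact hε z
  · rintro (_ | t) <;> rfl

/-! ### Prefixes -/

-- A token of `P` may be consumed in `Q` by a transition outside `P`, whereas its producer must lie
-- in `P`; hence the asymmetry between `prod` and `cons`.
open Classical in
theorem prefix_of_maps {P Q : TokProc N} (iS : P.S → Q.S) (iT : P.T → Q.T)
    (hS : Function.Injective iS) (hT : Function.Injective iT)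
    (prod : ∀ s, Q.prod (iS s) = (P.prod s).map iT)
    (cons : ∀ s t, Q.cons (iS s) = some (iT t) ↔ P.cons s = some t)
    (out : ∀ s, Q.prod s = none → s ∈ Set.range iS)
    (hπS : ∀ s, Q.πS (iS s) = P.πS s) (hπT : ∀ t, Q.πT (iT t) = P.πT t) :
    ∃ i : GRProcess.PrefixIncl P.toGR Q.toGR, ⇑i.iS = iS ∧ ⇑i.iT = iT := by
  refine ⟨⟨⟨iS, hS⟩, ⟨iT, hT⟩, fun (s : P.S) => ite_one_zero_congr ?_,
    fun (s : Q.S) hs => if_neg fun h => hs (out s h),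
    fun (t : P.T) (s : P.S) => ite_one_zero_congr (cons s t),
    fun (t : P.T) (s : P.S) => ite_one_zero_congr ?_, hπS, hπT⟩, rfl, rfl⟩
  · change Q.prod (iS s) = none ↔ _
    rw [prod, Option.map_eq_none_iff]
  · change Q.prod (iS s) = some (iT t) ↔ _
    rw [prod, map_eq_some_apply_iff hT]

theorem Iso.prefix {P Q : TokProc N} (i : Iso P Q) : GRProcess.Prefix P.toGR Q.toGR :=
  let ⟨j, _⟩ := prefix_of_maps i.φS i.φT i.φS.injective i.φT.injective i.prod
    (fun s t => by
      rw [i.cons, ← Option.map_some, (Option.map_injective i.φT.injective).eq_iff])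
    (fun s _ => i.φS.surjective s) i.πS i.πT
  ⟨j⟩

theorem prefix_restrict (P : TokProc N) (E : Set P.T) (hE : P.Closed E) :
    GRProcess.Prefix (P.restrict E hE).toGR P.toGR :=
  let ⟨j, _⟩ := prefix_of_maps (P := P.restrict E hE) (Q := P) Subtype.val Subtype.val
    Subtype.val_injective Subtype.val_injective
    (fun s => by
      change P.prod s.1 = Option.map _ (clip E (P.prod s.1))
      rcases h : P.prod s.1 with _ | t
      · simp [clip]
      · simp [clip, s.2 t h])
    (fun s t => clip_eq_some.symm)
    (fun s hs => ⟨⟨s, fun t ht => by simp [hs] at ht⟩, rfl⟩) (fun _ => rfl) (fun _ => rfl)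
  ⟨j⟩

/-- The maps are recorded because `none` lies outside the range of `some`, which refutes maximality.
-/
theorem exists_prefixIncl_add (P : TokProc N) {t : N.T} {A : Set P.S} (h : P.Addable t A) :
    ∃ i : GRProcess.PrefixIncl P.toGR (P.add t A h).toGR, ⇑i.iS = Sum.inl ∧ ⇑i.iT = some :=
  prefix_of_maps (P := P) (Q := P.add t A h) Sum.inl some Sum.inl_injective
    (Option.some_injective _) (fun _ => rfl)
    (fun s t => by
      by_cases hs : s ∈ A
      · simp [add, hs, h.cons_eq_none s hs]
      · simp [add, hs])
    (by
      rintro (s | s) hs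
      · exact ⟨s, rfl⟩
      · simp [add] at hs)
    (fun _ => rfl) (fun _ => rfl)

end TokProc

theorem GRProcess.Prefix.trans {N : PTNet.{u}} {P Q R : GRProcess N} (h₁ : Prefix P Q)
    (h₂ : Prefix Q R) : Prefix P R := by
  obtain ⟨i⟩ := h₁
  obtain ⟨j⟩ := h₂
  refine ⟨⟨i.iS.trans j.iS, i.iT.trans j.iT, fun s => (j.init _).trans (i.init s), fun s hs => ?_,
    fun t s => (j.pre _ _).trans (i.pre t s), fun t s => (j.post _ _).trans (i.post t s),
    fun s => (j.πS _).trans (i.πS s), fun t => (j.πT _).trans (i.πT t)⟩⟩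
  by_cases h : s ∈ Set.range j.iS
  · obtain ⟨q, rfl⟩ := h
    rw [j.init]
    refine i.init_out q ?_
    rintro ⟨p, rfl⟩
    exact hs ⟨p, rfl⟩
  · exact j.init_out s h

/-! ### Firing words and Parikh vectors in conflict-free nets -/

namespace PTNet
variable {N : PTNet.{u}}

/-- `t` is enabled after firing the transitions in `y`. -/
def Enabled (N : PTNet.{u}) (y : N.T →₀ ℕ) (t : N.T) : Prop :=
  ∀ s, N.preG y s + N.pre t s ≤ N.M₀ s + N.postG y s

/-- From the state in which the transitions in `y` have fired, one arrives by firing some word at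
the state in which the transitions in `z` have fired. -/
def Leads (N : PTNet.{u}) : (N.T →₀ ℕ) → (N.T →₀ ℕ) → Prop :=
  Relation.ReflTransGen fun y z => ∃ t, N.Enabled y t ∧ z = y + Finsupp.single t 1

@[simp] theorem preG_zero (s : N.S) : N.preG 0 s = 0 := by simp [preG]
@[simp] theorem postG_zero (s : N.S) : N.postG 0 s = 0 := by simp [postG]

@[simp] theorem preG_add (y z : N.T →₀ ℕ) (s : N.S) :
    N.preG (y + z) s = N.preG y s + N.preG z s := by
  classical
  exact Finsupp.sum_add_index (by simp) (by intros; ring)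

@[simp] theorem postG_add (y z : N.T →₀ ℕ) (s : N.S) :
    N.postG (y + z) s = N.postG y s + N.postG z s := by
  classical
  exact Finsupp.sum_add_index (by simp) (by intros; ring)

@[simp] theorem preG_single (t : N.T) (s : N.S) :
    N.preG (Finsupp.single t 1) s = N.pre t s := by simp [preG]

@[simp] theorem postG_single (t : N.T) (s : N.S) :
    N.postG (Finsupp.single t 1) s = N.post t s := by simp [postG]

/-- The marking that results from firing the transitions in `y`. -/
def marking (N : PTNet.{u}) (y : N.T →₀ ℕ) (s : N.S) : ℕ := N.M₀ s + N.postG y s - N.preG y s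

/-- The inequality says that the subtraction in `marking` does not truncate. -/
theorem reachable_of_leads {y : N.T →₀ ℕ} (h : N.Leads 0 y) :
    (∀ s, N.preG y s ≤ N.M₀ s + N.postG y s) ∧ N.Reachable (N.marking y) := by
  induction h with
  | refl =>
    refine ⟨by simp, ?_⟩
    have : N.marking 0 = N.M₀ := by funext s; simp [marking]
    rw [this]
    exact .refl
  | @tail y z _ hyz ih =>
    obtain ⟨t, ht, rfl⟩ := hyz
    refine ⟨fun s => ?_, ih.2.tail ⟨t, by simp, fun s => ?_, fun s => ?_⟩⟩ <;>
      have := ht s <;> simp only [preG_add, postG_add, preG_single, postG_single, marking] at * <;>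
      omega

theorem canStep_marking_iff {y G : N.T →₀ ℕ} (hy : ∀ s, N.preG y s ≤ N.M₀ s + N.postG y s) :
    N.CanStep (N.marking y) G ↔
      G ≠ 0 ∧ ∀ s, N.preG y s + N.preG G s ≤ N.M₀ s + N.postG y s := by
  constructor
  · rintro ⟨M', h1, h2, -⟩
    refine ⟨h1, fun s => ?_⟩
    have := h2 s
    have := hy s
    simp only [marking] at *
    omega
  · rintro ⟨h1, h2⟩
    refine ⟨_, h1, fun s => ?_, fun s => rfl⟩
    have := h2 s
    have := hy s
    simp only [marking] at *
    omega

/-- For `t ≠ u` the restrictions of the step to `t` and to `u` are single firings, so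
conflict-freeness applies. For `t = u` the restriction is the whole step, and nothing would follow.
-/
theorem ConflictFree.canStep_pair (hcf : N.ConflictFree) {y : N.T →₀ ℕ} (hy : N.Leads 0 y)
    {t u : N.T} (ht : N.Enabled y t) (hu : N.Enabled y u) (htu : t ≠ u) :
    N.CanStep (N.marking y) (Finsupp.single t 1 + Finsupp.single u 1) := by
  classical
  obtain ⟨h1, h2⟩ := reachable_of_leads hy
  by_contra hG
  refine hcf _ h2 _ ⟨fun h => ?_, hG, fun v hv => ?_⟩
  · have := DFunLike.congr_fun h t
    simp at this
  · have hv' : v = t ∨ v = u := by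
      by_contra! h
      simp [h.1.symm, h.2.symm] at hv
    rw [canStep_marking_iff h1]
    rcases hv' with rfl | rfl
    · simpa [Finsupp.single_apply, htu, htu.symm, Enabled] using ht
    · simpa [Finsupp.single_apply, htu, htu.symm, Enabled] using hu

theorem ConflictFree.pair_le (hcf : N.ConflictFree) {y : N.T →₀ ℕ} (hy : N.Leads 0 y)
    {t u : N.T} (ht : N.Enabled y t) (hu : N.Enabled y u) (htu : t ≠ u) (s : N.S) :
    N.preG y s + (N.pre t s + N.pre u s) ≤ N.M₀ s + N.postG y s := by
  have := ((canStep_marking_iff (reachable_of_leads hy).1).1 (hcf.canStep_pair hy ht hu htu)).2 s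
  simpa using this

theorem ConflictFree.enabled_add (hcf : N.ConflictFree) {y : N.T →₀ ℕ} (hy : N.Leads 0 y)
    {t u : N.T} (ht : N.Enabled y t) (hu : N.Enabled y u) (htu : t ≠ u) :
    N.Enabled (y + Finsupp.single t 1) u := by
  intro s
  have := hcf.pair_le hy ht hu htu s
  simp only [preG_add, postG_add, preG_single, postG_single]
  omega

/-- Persistence: `t` stays enabled along the word from `x` to `z` until it occurs. If it occurs, its
first occurrence can be moved to the front; if not, it can be fired before or after the whole word.
-/
theorem ConflictFree.residual (hcf : N.ConflictFree) {x z : N.T →₀ ℕ} (hx : N.Leads 0 x)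
    (hxz : N.Leads x z) {t : N.T} (ht : N.Enabled x t) :
    (x t < z t ∧ N.Leads (x + Finsupp.single t 1) z) ∨
      (z t = x t ∧ N.Enabled z t ∧
        N.Leads (x + Finsupp.single t 1) (z + Finsupp.single t 1)) := by
  classical
  induction hxz with
  | refl => exact Or.inr ⟨rfl, ht, .refl⟩
  | @tail z w hxz hzw ih =>
    obtain ⟨u, hu, rfl⟩ := hzw
    rcases ih with ⟨h1, h2⟩ | ⟨h1, h2, h3⟩
    · refine Or.inl ⟨?_, h2.tail ⟨u, hu, rfl⟩⟩
      rw [Finsupp.add_apply]; omega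
    · by_cases htu : t = u
      · subst htu
        exact Or.inl ⟨by simp [h1], h3⟩
      · have hz := hx.trans hxz
        refine Or.inr ⟨by simp [h1, Ne.symm htu],
          hcf.enabled_add hz hu h2 (Ne.symm htu), h3.tail ⟨u, hcf.enabled_add hz h2 hu htu, ?_⟩⟩
        exact add_right_comm _ _ _

theorem ConflictFree.enabled_of_leads (hcf : N.ConflictFree) {x z : N.T →₀ ℕ} (hx : N.Leads 0 x)
    (hxz : N.Leads x z) {t : N.T} (ht : N.Enabled x t) (h : z t = x t) : N.Enabled z t := by
  rcases hcf.residual hx hxz ht with h' | h'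
  · omega
  · exact h'.2.1

theorem Leads.le {x z : N.T →₀ ℕ} (h : N.Leads x z) : x ≤ z := by
  induction h with
  | refl => exact le_rfl
  | tail _ hzw ih =>
    obtain ⟨u, _, rfl⟩ := hzw
    exact ih.trans le_self_add

/-- The letters of a word leading to `y` are moved, one after the other, to the front of a word
leading to `z`. The second alternative of `residual` cannot arise, since `z` contains at least as
many occurrences of each letter as `y`. -/
theorem ConflictFree.leads_of_le (hcf : N.ConflictFree) {y z : N.T →₀ ℕ}
    (hy : N.Leads 0 y) (hz : N.Leads 0 z) (hyz : y ≤ z) : N.Leads y z := by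
  have key : ∀ x, N.Leads x y → N.Leads 0 x → N.Leads x z → N.Leads y z := by
    intro x hxy
    induction hxy using Relation.ReflTransGen.head_induction_on with
    | refl => exact fun _ h => h
    | @head x x' hxx' hxy ih =>
      obtain ⟨t, ht, rfl⟩ := hxx'
      intro h0 hxz
      refine ih (h0.tail ⟨t, ht, rfl⟩) ?_
      rcases hcf.residual h0 hxz ht with h | h
      · exact h.2
      · have h1 := Leads.le hxy t
        have h2 := hyz t
        simp at h1
        omega
  exact key 0 hy .refl hz

end PTNet

/-! ### Parikh vectors of finite processes -/

theorem encard_setOf_mem_finset {X O : Type u} (c : X → O) (q : X → Prop) (F : Finset O) :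
    {x | c x ∈ F ∧ q x}.encard = ∑ o ∈ F, {x | c x = o ∧ q x}.encard := by
  classical
  induction F using Finset.induction_on with
  | empty => simp
  | insert o F ho ih =>
    rw [Finset.sum_insert ho, ← ih, ← Set.encard_union_eq]
    · congr 1
      ext x
      simp [or_and_right]
    · rw [Set.disjoint_left]
      rintro x ⟨rfl, _⟩ ⟨h, _⟩
      exact ho h

theorem encard_setOf_option {X T : Type u} [Fintype T] (c : X → Option T) (q : X → Prop) :
    {x | q x}.encard = {x | c x = none ∧ q x}.encard + ∑ t, {x | c x = some t ∧ q x}.encard := by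
  rw [← Fintype.sum_option (fun o => {x | c x = o ∧ q x}.encard), ← encard_setOf_mem_finset]
  simp

namespace TokProc
variable {N : PTNet.{u}}

/-- The number of occurrences of each transition of `N` in `E`. -/
noncomputable def parikhOn (P : TokProc N) (E : Finset P.T) : N.T →₀ ℕ :=
  ∑ e ∈ E, Finsupp.single (P.πT e) 1

/-- The number of occurrences of each transition of `N` in the finite process `P`. -/
noncomputable def parikh (P : TokProc N) : N.T →₀ ℕ := ∑ᶠ e, Finsupp.single (P.πT e) 1

theorem parikh_eq (P : TokProc N) [Fintype P.T] : P.parikh = P.parikhOn Finset.univ :=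
  finsum_eq_sum_of_fintype _

theorem parikh_restrict (P : TokProc N) (E : Finset P.T) (hE : P.Closed E) :
    (P.restrict E hE).parikh = P.parikhOn E := by
  unfold parikh parikhOn
  rw [← finsum_mem_coe_finset]
  exact finsum_set_coe_eq_finsum_mem (f := fun e => Finsupp.single (P.πT e) 1) (E : Set P.T)

theorem Iso.parikh {P Q : TokProc N} (i : Iso P Q) : P.parikh = Q.parikh := by
  unfold TokProc.parikh
  rw [← finsum_comp_equiv i.φT]
  simp only [i.πT]

theorem parikh_add (P : TokProc N) [Finite P.T] {t : N.T} {A : Set P.S} (h : P.Addable t A) :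
    (P.add t A h).parikh = P.parikh + Finsupp.single t 1 := by
  have := Fintype.ofFinite P.T
  unfold parikh
  rw [finsum_eq_sum_of_fintype, finsum_eq_sum_of_fintype, Fintype.sum_option, add_comm]
  rfl

theorem preG_parikhOn (P : TokProc N) (E : Finset P.T) (x : N.S) :
    N.preG (P.parikhOn E) x = ∑ e ∈ E, N.pre (P.πT e) x := by
  classical
  unfold parikhOn
  induction E using Finset.induction_on with
  | empty => simp
  | insert e E he ih => simp [Finset.sum_insert he, ih]

theorem postG_parikhOn (P : TokProc N) (E : Finset P.T) (x : N.S) :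
    N.postG (P.parikhOn E) x = ∑ e ∈ E, N.post (P.πT e) x := by
  classical
  unfold parikhOn
  induction E using Finset.induction_on with
  | empty => simp
  | insert e E he ih => simp [Finset.sum_insert he, ih]

/-- The unconsumed places of a finite process carry the marking reached by the process. -/
theorem encard_unconsumed (P : TokProc N) [Finite P.T] (x : N.S) :
    {s | P.cons s = none ∧ P.πS s = x}.encard + (N.preG P.parikh x : ℕ∞) =
      (N.M₀ x : ℕ∞) + (N.postG P.parikh x : ℕ∞) := by
  have := Fintype.ofFinite P.T
  -- The places labelled `x` are counted in two ways, by consumer and by producer.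
  have h1 := encard_setOf_option P.cons (fun s => P.πS s = x)
  have h2 := encard_setOf_option P.prod (fun s => P.πS s = x)
  simp only [P.pre_card] at h1
  simp only [P.post_card, P.init_card] at h2
  rw [P.parikh_eq, preG_parikhOn, postG_parikhOn]
  push_cast
  rw [← h1, ← h2]

theorem exists_addable_subset (P : TokProc N) {t : N.T} (D : Set P.S)
    (hD : ∀ s ∈ D, P.cons s = none)
    (hc : ∀ x, (N.pre t x : ℕ∞) ≤ {s | s ∈ D ∧ P.πS s = x}.encard) :
    ∃ A ⊆ D, P.Addable t A := by
  choose B hB hBc using fun x => Set.exists_subset_encard_eq (hc x)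
  refine ⟨⋃ x, B x, ?_, ?_, fun x => ?_⟩
  · intro s hs
    obtain ⟨x, hx⟩ := Set.mem_iUnion.1 hs
    exact (hB x hx).1
  · intro s hs
    obtain ⟨x, hx⟩ := Set.mem_iUnion.1 hs
    exact hD s (hB x hx).1
  · rw [← hBc x]
    congr 1
    ext s
    constructor
    · rintro ⟨hs, rfl⟩
      obtain ⟨y, hy⟩ := Set.mem_iUnion.1 hs
      obtain rfl : P.πS s = y := (hB y hy).2
      exact hy
    · intro hs
      exact ⟨Set.mem_iUnion.2 ⟨x, hs⟩, (hB x hs).2⟩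

theorem Addable.pre_le {P : TokProc N} {t : N.T} {A : Set P.S} (h : P.Addable t A) (x : N.S) :
    (N.pre t x : ℕ∞) ≤ {s | P.cons s = none ∧ P.πS s = x}.encard := by
  rw [← h.card x]
  exact Set.encard_le_encard fun s hs => ⟨h.cons_eq_none s hs.1, hs.2⟩

/-- By `encard_unconsumed` the unconsumed tokens form the marking; the same equation shows that
those on `x` are finite in number. -/
theorem pre_le_iff_enabled (P : TokProc N) [Finite P.T] (t : N.T) :
    (∀ x, (N.pre t x : ℕ∞) ≤ {s | P.cons s = none ∧ P.πS s = x}.encard) ↔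
      N.Enabled P.parikh t := by
  refine forall_congr' fun x => ?_
  have h := P.encard_unconsumed x
  generalize {s | P.cons s = none ∧ P.πS s = x}.encard = c at h
  rw [← ENat.natCast_add (N.M₀ x)] at h
  lift c to ℕ using (fun hc => by rw [hc, top_add] at h; exact ENat.top_ne_natCast _ h)
  norm_cast at h ⊢
  omega

theorem exists_addable_iff_enabled (P : TokProc N) [Finite P.T] (t : N.T) :
    (∃ A, P.Addable t A) ↔ N.Enabled P.parikh t := by
  rw [← P.pre_le_iff_enabled]
  constructor
  · rintro ⟨A, hA⟩ x
    exact hA.pre_le x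
  · intro h
    obtain ⟨A, -, hA⟩ := P.exists_addable_subset {s | P.cons s = none} (fun s hs => hs) h
    exact ⟨A, hA⟩

/-- Once `A` is chosen, the hypothesis still leaves enough unconsumed tokens outside `A` for `u`. -/
theorem exists_disjoint_addable (P : TokProc N) [Finite P.T] {t u : N.T}
    (h : ∀ s, N.preG P.parikh s + (N.pre t s + N.pre u s) ≤ N.M₀ s + N.postG P.parikh s) :
    ∃ A B, P.Addable t A ∧ P.Addable u B ∧ Disjoint A B := by
  obtain ⟨A, hA⟩ := (P.exists_addable_iff_enabled t).2 fun s => by have := h s; omega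
  obtain ⟨B, hBD, hB⟩ := P.exists_addable_subset (t := u) {s | P.cons s = none ∧ s ∉ A}
    (fun s hs => hs.1) (fun x => by
      have hc := P.encard_unconsumed x
      have hu : {s | P.cons s = none ∧ P.πS s = x} = {s | s ∈ A ∧ P.πS s = x} ∪
          {s | s ∈ {s | P.cons s = none ∧ s ∉ A} ∧ P.πS s = x} := by
        ext s
        by_cases hs : s ∈ A
        · simp [hs, hA.cons_eq_none s hs]
        · simp [hs]
      rw [hu, Set.encard_union_eq (Set.disjoint_left.2 fun s hs hs' => hs'.1.2 hs.1),
        hA.card x] at hc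
      have hx := h x
      generalize {s | s ∈ {s | P.cons s = none ∧ s ∉ A} ∧ P.πS s = x}.encard = c at hc ⊢
      rw [← ENat.natCast_add (N.M₀ x)] at hc
      lift c to ℕ using (fun hc' => by
        rw [hc', add_top, top_add] at hc; exact ENat.top_ne_natCast _ hc)
      norm_cast at hc ⊢
      omega)
  exact ⟨A, B, hA, hB, Set.disjoint_left.2 fun s hs hs' => (hBD hs').2 hs⟩

end TokProc

/-! ### Swapping equivalence of finite extensions -/

def LabelledNet.Iso.trans {N : PTNet.{u}} {P Q R : LabelledNet N} (i : Iso P Q) (j : Iso Q R) :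
    Iso P R :=
  ⟨i.φS.trans j.φS, i.φT.trans j.φT, fun s => (j.map_init _).trans (i.map_init s),
    fun t s => (j.map_pre _ _).trans (i.map_pre t s),
    fun t s => (j.map_post _ _).trans (i.map_post t s),
    fun s => (j.map_πS _).trans (i.map_πS s), fun t => (j.map_πT _).trans (i.map_πT t)⟩

theorem swap_inl_inl {X Y : Type u} {_ : DecidableEq X} {_ : DecidableEq (X ⊕ Y)} (p q s : X) :
    Equiv.swap (Sum.inl p : X ⊕ Y) (Sum.inl q) (Sum.inl s) = Sum.inl (Equiv.swap p q s) := by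
  simp only [Equiv.swap_apply_def, Sum.inl.injEq]
  split_ifs <;> rfl

theorem swap_inl_inr {X Y : Type u} {_ : DecidableEq (X ⊕ Y)} (p q : X) (y : Y) :
    Equiv.swap (Sum.inl p : X ⊕ Y) (Sum.inl q) (Sum.inr y) = Sum.inr y := by
  simp [Equiv.swap_apply_def]

namespace TokProc
variable {N : PTNet.{u}}

def SwapOne (P Q : TokProc N) : Prop :=
  ∃ p q, ∃ h : P.Swappable p q, Nonempty (Iso (P.swap p q h) Q)

/-- Equivalence up to finitely many swaps and isomorphisms. -/
def SwapEq : TokProc N → TokProc N → Prop :=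
  Relation.ReflTransGen fun P Q => SwapOne P Q ∨ Nonempty (Iso P Q)

theorem SwapEq.of_iso {P Q : TokProc N} (i : Iso P Q) : SwapEq P Q := .single (Or.inr ⟨i⟩)

theorem SwapOne.toGR {P Q : TokProc N} (h : SwapOne P Q) : GRProcess.SwapOne P.toGR Q.toGR := by
  obtain ⟨p, q, hpq, ⟨i⟩⟩ := h
  obtain ⟨h1, h2, h3⟩ := (P.swappable_iff p q).1 hpq
  obtain ⟨j⟩ := P.swap_toLabelled p q hpq
  obtain ⟨k⟩ := i.toLabelled
  exact ⟨p, q, h1, h2, h3, ⟨j.trans k⟩⟩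

noncomputable def swapIso (P : TokProc N) {p q : P.S} (h : P.Swappable p q)
    (hpq : P.cons p = P.cons q) : Iso (P.swap p q h) P where
  φS := .refl _
  φT := .refl _
  prod s := by simp
  cons s := by
    simp only [Equiv.refl_apply, Equiv.coe_refl, Option.map_id_fun, id, Equiv.swap_apply_def]
    split_ifs <;> simp_all
  πS _ := rfl
  πT _ := rfl

theorem swappable_self (P : TokProc N) (p : P.S) : P.Swappable p p :=
  ⟨P.wf.transGen.irrefl.irrefl p, P.wf.transGen.irrefl.irrefl p, rfl⟩

theorem Iso.swapOne {P Q : TokProc N} (i : Iso P Q) (p : P.S) : SwapOne P Q :=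
  ⟨p, p, P.swappable_self p, ⟨(P.swapIso (P.swappable_self p) rfl).trans i⟩⟩

/-- An isomorphism is a one-step swap of a place with itself, provided that there is a place. A
process without places admits no swaps, so there the chain consists of isomorphisms only; this is
the second alternative. -/
theorem SwapEq.toGR {P Q : TokProc N} (h : SwapEq P Q) :
    GRProcess.SwapStar P.toGR Q.toGR ∨ Nonempty (Iso P Q) := by
  by_cases hP : Nonempty P.S
  · left
    have : GRProcess.SwapStar P.toGR Q.toGR ∧ Nonempty Q.S := by
      induction h with
      | refl => exact ⟨.refl, hP⟩
      | tail _ h ih =>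
        obtain ⟨ih, ⟨b⟩⟩ := ih
        rcases h with h | ⟨⟨i⟩⟩
        · refine ⟨ih.tail h.toGR, ?_⟩
          obtain ⟨_, _, _, ⟨i⟩⟩ := h
          exact ⟨i.φS b⟩
        · exact ⟨ih.tail (i.swapOne b).toGR, ⟨i.φS b⟩⟩
    exact this.1
  · right
    induction h with
    | refl => exact ⟨.refl P⟩
    | tail _ h ih =>
      obtain ⟨i⟩ := ih
      rcases h with ⟨p, _⟩ | ⟨⟨j⟩⟩
      · exact (hP ⟨i.φS.symm p⟩).elim
      · exact ⟨i.trans j⟩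

/-! ### Growing by one transition -/

def Grow (t : N.T) (P Q : TokProc N) : Prop :=
  ∃ A, ∃ h : P.Addable t A, Nonempty (Iso (P.add t A h) Q)

theorem Grow.of_add {P : TokProc N} {t : N.T} {A : Set P.S} (h : P.Addable t A) :
    Grow t P (P.add t A h) := ⟨A, h, ⟨.refl _⟩⟩

theorem lt_of_add {P : TokProc N} {t : N.T} {A : Set P.S} (h : P.Addable t A) {p q : P.S}
    (hpq : Relation.TransGen (P.add t A h).lt (Sum.inl p) (Sum.inl q)) :
    Relation.TransGen P.lt p q := by
  have step : ∀ a, ∀ b : P.S, (P.add t A h).lt a (Sum.inl b) → ∃ c, a = Sum.inl c ∧ P.lt c b := by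
    rintro (a | a) b ⟨e, h1, h2⟩
    · refine ⟨a, rfl, ?_⟩
      obtain ⟨e, he, rfl⟩ := Option.map_eq_some_iff.1 h2
      by_cases ha : a ∈ A
      · simp [ha] at h1
      · exact ⟨e, by simpa [ha] using h1, he⟩
    · simp at h1
  have key : ∀ x, Relation.TransGen (P.add t A h).lt x (Sum.inl q) →
      ∀ a, x = Sum.inl a → Relation.TransGen P.lt a q := by
    intro x hx
    induction hx using Relation.TransGen.head_induction_on with
    | single hx =>
      rintro a rfl
      obtain ⟨c, hc, h⟩ := step _ _ hx
      cases hc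
      exact .single h
    | @head x y hxy hyq ih =>
      rintro a rfl
      have hy : ∃ c, y = Sum.inl c := by
        rcases Relation.TransGen.head'_iff.1 hyq with ⟨z, ⟨e, he, -⟩, -⟩
        rcases y with c | c
        · exact ⟨c, rfl⟩
        · simp at he
      obtain ⟨c, rfl⟩ := hy
      obtain ⟨d, hd, h⟩ := step _ _ hxy
      cases hd
      exact .head h (ih c rfl)
  exact key _ hpq p rfl

theorem Swappable.add {P : TokProc N} {p q : P.S} (hpq : P.Swappable p q) {t : N.T} {A : Set P.S}
    (h : P.Addable t A) : (P.add t A h).Swappable (Sum.inl p) (Sum.inl q) :=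
  ⟨fun h' => hpq.not_lt (lt_of_add h h'), fun h' => hpq.not_gt (lt_of_add h h'), hpq.label⟩

open Classical in
theorem Addable.swap {P : TokProc N} {t : N.T} {A : Set P.S} (h : P.Addable t A) {p q : P.S}
    (hpq : P.Swappable p q) : (P.swap p q hpq).Addable t (Equiv.swap p q ⁻¹' A) where
  cons_eq_none s hs := h.cons_eq_none _ hs
  card x := by
    rw [← h.card x, ← encard_preimage_equiv (Equiv.swap p q)]
    congr 1
    ext s
    simp [πS_swap_apply hpq.label]

open Classical in
theorem add_swap_iso {P : TokProc N} {t : N.T} {A : Set P.S} (h : P.Addable t A) {p q : P.S}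
    (hpq : P.Swappable p q) :
    Nonempty (Iso ((P.add t A h).swap (Sum.inl p) (Sum.inl q) (hpq.add h))
      ((P.swap p q hpq).add t (Equiv.swap p q ⁻¹' A) (h.swap hpq))) := by
  refine ⟨⟨.refl _, .refl _, fun s => ?_, ?_, fun s => rfl, fun _ => rfl⟩⟩
  · simp
  · rintro (s | s)
    · change (if Equiv.swap p q s ∈ A then some none else (P.cons (Equiv.swap p q s)).map some) =
        Option.map id ((P.add t A h).cons (@Equiv.swap (P.add t A h).S
          (fun _ _ => Classical.propDecidable _) (Sum.inl p) (Sum.inl q) (Sum.inl s)))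
      rw [Option.map_id, id]
      exact (congrArg (P.add t A h).cons (swap_inl_inl p q s)).symm
    · change none =
        Option.map id ((P.add t A h).cons (@Equiv.swap (P.add t A h).S
          (fun _ _ => Classical.propDecidable _) (Sum.inl p) (Sum.inl q) (Sum.inr s)))
      rw [Option.map_id, id]
      exact (congrArg (P.add t A h).cons (swap_inl_inr p q s)).symm

theorem Iso.grow {P Q R : TokProc N} (i : Iso P Q) {t : N.T} (h : Grow t P R) : Grow t Q R := by
  obtain ⟨A, hA, ⟨j⟩⟩ := h
  exact ⟨_, hA.map i, ⟨(i.add hA).symm.trans j⟩⟩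

/-- A swap of the smaller process is also a swap of its extension, where it moves the preset of the
added transition along (`add_swap_iso`). -/
theorem exists_grow_of_swapEq {P₀ Q₀ P₁ : TokProc N} {t : N.T} (h : SwapEq P₀ Q₀)
    (hP : Grow t P₀ P₁) : ∃ Q₁, Grow t Q₀ Q₁ ∧ SwapEq P₁ Q₁ := by
  induction h with
  | refl => exact ⟨P₁, hP, .refl⟩
  | tail _ h ih =>
    obtain ⟨R, hR, hPR⟩ := ih
    rcases h with ⟨p, q, hpq, ⟨i⟩⟩ | ⟨⟨i⟩⟩
    · obtain ⟨A, hA, ⟨j⟩⟩ := hR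
      obtain ⟨k⟩ := add_swap_iso hA hpq
      refine ⟨_, i.grow (.of_add (hA.swap hpq)), ?_⟩
      exact (hPR.tail (Or.inr ⟨j.symm⟩)).tail (Or.inl ⟨_, _, hpq.add hA, ⟨k⟩⟩)
    · exact ⟨R, i.grow hR, hPR⟩

theorem Addable.finite {P : TokProc N} {t : N.T} {A : Set P.S} (h : P.Addable t A) : A.Finite :=
  finite_of_encard_fiber h.card (N.pre_finite t)

theorem Addable.fiber_eq_of_subset {P : TokProc N} {t : N.T} {A B : Set P.S} (hA : P.Addable t A)
    (hB : P.Addable t B) {x : N.S} (h : ∀ s ∈ A, P.πS s = x → s ∈ B) :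
    ∀ s ∈ B, P.πS s = x → s ∈ A := by
  have : {s | s ∈ A ∧ P.πS s = x} = {s | s ∈ B ∧ P.πS s = x} := by
    refine Set.Finite.eq_of_subset_of_encard_le' (Set.finite_of_encard_eq_coe (hB.card x))
      (fun s hs => ⟨h s hs.1 hs.2, hs.2⟩) ?_
    rw [hA.card, hB.card]
  intro s hs hx
  exact (this.ge ⟨hs, hx⟩).1

theorem swappable_of_cons_eq_none {P : TokProc N} {a b : P.S} (ha : P.cons a = none)
    (hb : P.cons b = none) (h : P.πS a = P.πS b) : P.Swappable a b := by
  refine ⟨fun h' => ?_, fun h' => ?_, h⟩ <;>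
    obtain ⟨c, ⟨e, he, -⟩, -⟩ := Relation.TransGen.head'_iff.1 h'
  · simp [ha] at he
  · simp [hb] at he

/-- A token `a ∈ A \ B` is exchanged for some `b ∈ B \ A` with the same label. Both are unconsumed
in `P`, so the swap only redirects the new transition, and `A \ B` shrinks. -/
theorem swapEq_add_add {P : TokProc N} {t : N.T} {A B : Set P.S} (hA : P.Addable t A)
    (hB : P.Addable t B) : SwapEq (P.add t A hA) (P.add t B hB) := by
  classical
  induction hn : (A \ B).ncard using Nat.strong_induction_on generalizing A with
  | _ n ih =>
    by_cases hAB : A ⊆ B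
    · obtain rfl : A = B := hAB.antisymm fun s hs =>
        hA.fiber_eq_of_subset hB (fun s hs _ => hAB hs) s hs rfl
      exact .refl
    · obtain ⟨a, haA, haB⟩ := Set.not_subset.1 hAB
      -- Otherwise all tokens of `B` with the label of `a` would lie in `A`; as `A` and `B` have
      -- equally many of them, `a` would lie in `B`.
      obtain ⟨b, hbB, hba, hbA⟩ : ∃ b ∈ B, P.πS b = P.πS a ∧ b ∉ A := by
        by_contra! h
        exact haB (hB.fiber_eq_of_subset hA h a haA rfl)
      have hab := swappable_of_cons_eq_none (hA.cons_eq_none a haA) (hB.cons_eq_none b hbB) hba.symm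
      have hA' : P.Addable t (Equiv.swap a b ⁻¹' A) := by
        refine ⟨fun s hs => ?_, (hA.swap hab).card⟩
        have := hA.cons_eq_none _ hs
        rw [Equiv.swap_apply_def] at this
        split_ifs at this with h1 h2
        · rw [h1, hA.cons_eq_none a haA]
        · rw [h2, hB.cons_eq_none b hbB]
        · exact this
      have j : Iso ((P.swap a b hab).add t _ (hA.swap hab)) (P.add t _ hA') := by
        have := (P.swapIso hab (by rw [hA.cons_eq_none a haA, hB.cons_eq_none b hbB])).add
          (hA.swap hab)
        have e : (P.swapIso hab (by rw [hA.cons_eq_none a haA, hB.cons_eq_none b hbB])).φS ''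
          (Equiv.swap a b ⁻¹' A) = Equiv.swap a b ⁻¹' A := Set.image_id _
        simp only [e] at this
        exact this
      obtain ⟨k⟩ := add_swap_iso hA hab
      have hlt : ((Equiv.swap a b ⁻¹' A) \ B).ncard < n := by
        rw [← hn]
        refine Set.ncard_lt_ncard ⟨?_, fun h => ?_⟩ (hA.finite.subset Set.sdiff_subset)
        · rintro s ⟨hs, hsB⟩
          refine ⟨?_, hsB⟩
          by_cases hsa : s = a
          · rw [hsa]; exact haA
          · rw [Set.mem_preimage, Equiv.swap_apply_of_ne_of_ne hsa (by rintro rfl; exact hsB hbB)]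
              at hs
            exact hs
        · have := (h ⟨haA, haB⟩).1
          rw [Set.mem_preimage, Equiv.swap_apply_left] at this
          exact hbA this
      exact .head (Or.inl ⟨_, _, hab.add hA, ⟨k.trans j⟩⟩) (ih _ hlt hA' rfl)

theorem swapEq_of_grow {P₀ Q₀ P₁ Q₁ : TokProc N} {t : N.T} (h : SwapEq P₀ Q₀)
    (hP : Grow t P₀ P₁) (hQ : Grow t Q₀ Q₁) : SwapEq P₁ Q₁ := by
  obtain ⟨R, ⟨A, hA, ⟨i⟩⟩, hR⟩ := exists_grow_of_swapEq h hP
  obtain ⟨B, hB, ⟨j⟩⟩ := hQ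
  exact ((hR.tail (Or.inr ⟨i.symm⟩)).trans (swapEq_add_add hA hB)).tail (Or.inr ⟨j⟩)

theorem Addable.add {P : TokProc N} {t u : N.T} {A B : Set P.S} (hA : P.Addable t A)
    (hB : P.Addable u B) (hAB : Disjoint A B) : (P.add t A hA).Addable u (Sum.inl '' B) where
  cons_eq_none := by
    rintro _ ⟨s, hs, rfl⟩
    simp [Set.disjoint_right.1 hAB hs, hB.cons_eq_none s hs]
  card x := (encard_setOf_sum_of_inl (by simp) (by simp)).trans (hB.card x)

theorem add_add_iso {P : TokProc N} {t u : N.T} {A B : Set P.S} (hA : P.Addable t A)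
    (hB : P.Addable u B) (hAB : Disjoint A B) :
    Nonempty (Iso ((P.add t A hA).add u _ (hA.add hB hAB))
      ((P.add u B hB).add t _ (hB.add hA hAB.symm))) := by
  refine ⟨⟨⟨Sum.elim (Sum.elim (fun s => .inl (.inl s)) .inr) fun y => .inl (.inr y),
    Sum.elim (Sum.elim (fun s => .inl (.inl s)) .inr) fun y => .inl (.inr y), ?_, ?_⟩,
    ⟨fun o => o.elim (some none) fun o => o.elim none fun t => some (some t),
    fun o => o.elim (some none) fun o => o.elim none fun t => some (some t), ?_, ?_⟩,
    ?_, ?_, ?_, ?_⟩⟩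
  · rintro ((s | s) | s) <;> rfl
  · rintro ((s | s) | s) <;> rfl
  · rintro (_ | _ | t) <;> rfl
  · rintro (_ | _ | t) <;> rfl
  · rintro ((s | s) | s)
    · change Option.map some (Option.map some (P.prod s)) =
        Option.map _ (Option.map some (Option.map some (P.prod s)))
      cases P.prod s <;> rfl
    · rfl
    · rfl
  · rintro ((s | s) | s)
    · by_cases h1 : s ∈ A
      · have h2 := Set.disjoint_left.1 hAB h1
        simp [h1, h2]
      · by_cases h2 : s ∈ B
        · simp [h1, h2]
        · simp only [h1, h2, Equiv.coe_fn_mk, Sum.elim_inl, Set.mem_image, Sum.inl.injEq,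
            exists_eq_right, if_false]
          cases P.cons s <;> rfl
    · simp
    · simp
  · rintro ((s | s) | s) <;> rfl
  · rintro (_ | _ | t) <;> rfl

/-! ### Growing by several transitions -/

def GrowN : ℕ → TokProc N → TokProc N → Prop
  | 0, P, Q => Nonempty (Iso P Q)
  | n + 1, P, Q => ∃ t R, Grow t P R ∧ GrowN n R Q

theorem GrowN.trans_iso {n : ℕ} {P Q R : TokProc N} (h : GrowN n P Q) (i : Iso Q R) :
    GrowN n P R := by
  induction n generalizing P with
  | zero => exact h.map fun j => j.trans i
  | succ n ih =>
    obtain ⟨t, P', hP', h⟩ := h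
    exact ⟨t, P', hP', ih h⟩

theorem Grow.finite {P Q : TokProc N} {t : N.T} (h : Grow t P Q) (hP : Finite P.T) :
    Finite Q.T := by
  obtain ⟨A, hA, ⟨i⟩⟩ := h
  exact Finite.of_equiv (Option P.T) i.φT

theorem Grow.parikh {P Q : TokProc N} {t : N.T} (h : Grow t P Q) (hP : Finite P.T) :
    Q.parikh = P.parikh + Finsupp.single t 1 := by
  obtain ⟨A, hA, ⟨i⟩⟩ := h
  rw [← i.parikh, parikh_add]

theorem Grow.enabled {P Q : TokProc N} {t : N.T} (h : Grow t P Q) (hP : Finite P.T) :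
    N.Enabled P.parikh t := by
  obtain ⟨A, hA, -⟩ := h
  exact (P.exists_addable_iff_enabled t).1 ⟨A, hA⟩

theorem Grow.prefix {P Q : TokProc N} {t : N.T} (h : Grow t P Q) :
    GRProcess.Prefix P.toGR Q.toGR := by
  obtain ⟨A, hA, ⟨i⟩⟩ := h
  obtain ⟨j, -⟩ := P.exists_prefixIncl_add hA
  exact GRProcess.Prefix.trans ⟨j⟩ i.prefix

theorem GrowN.prefix {n : ℕ} {P Q : TokProc N} (h : GrowN n P Q) :
    GRProcess.Prefix P.toGR Q.toGR := by
  induction n generalizing P with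
  | zero =>
    obtain ⟨i⟩ := h
    exact i.prefix
  | succ n ih =>
    obtain ⟨t, R, hR, h⟩ := h
    exact hR.prefix.trans (ih h)

theorem GrowN.finite {n : ℕ} {P Q : TokProc N} (h : GrowN n P Q) (hP : Finite P.T) :
    Finite Q.T := by
  induction n generalizing P with
  | zero =>
    obtain ⟨i⟩ := h
    exact Finite.of_equiv _ i.φT
  | succ n ih =>
    obtain ⟨t, R, hR, h⟩ := h
    exact ih h (hR.finite hP)

theorem GrowN.leads {n : ℕ} {P Q : TokProc N} (h : GrowN n P Q) (hP : Finite P.T) :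
    N.Leads P.parikh Q.parikh := by
  induction n generalizing P with
  | zero =>
    obtain ⟨i⟩ := h
    rw [i.parikh]
    exact .refl
  | succ n ih =>
    obtain ⟨t, R, hR, h⟩ := h
    exact .head ⟨t, hR.enabled hP, hR.parikh hP⟩ (ih h (hR.finite hP))

theorem GrowN.degree {n : ℕ} {P Q : TokProc N} (h : GrowN n P Q) (hP : Finite P.T) :
    Q.parikh.degree = P.parikh.degree + n := by
  induction n generalizing P with
  | zero =>
    obtain ⟨i⟩ := h
    rw [i.parikh, add_zero]
  | succ n ih =>
    obtain ⟨t, R, hR, h⟩ := h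
    rw [ih h (hR.finite hP), hR.parikh hP, map_add, Finsupp.degree_single]
    ring

theorem exists_growN_of_leads {P : TokProc N} (hP : Finite P.T) {z : N.T →₀ ℕ}
    (h : N.Leads P.parikh z) : ∃ n Q, GrowN n P Q ∧ Q.parikh = z := by
  have key : ∀ y, N.Leads y z → ∀ P : TokProc N, Finite P.T → P.parikh = y →
      ∃ n Q, GrowN n P Q ∧ Q.parikh = z := by
    intro y hy
    induction hy using Relation.ReflTransGen.head_induction_on with
    | refl => exact fun P _ hP => ⟨0, P, ⟨.refl P⟩, hP⟩
    | @head y y' hyy' _ ih =>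
      rintro P hP rfl
      obtain ⟨t, ht, rfl⟩ := hyy'
      obtain ⟨A, hA⟩ := (P.exists_addable_iff_enabled t).2 ht
      have hg := Grow.of_add hA
      obtain ⟨n, Q, h1, h2⟩ := ih _ (hg.finite hP) (hg.parikh hP)
      exact ⟨n + 1, Q, ⟨t, _, hg, h1⟩, h2⟩
  exact key _ h P hP rfl

/-- Equal first transitions are absorbed by `swapEq_of_grow`. If they differ, a third process `P₃`
is built that starts with `t` and `u`, in either order. Then `P` and `P₃` can both start with `t`,
while `P₃` and `Q` can both start with `u`, and induction applies to each pair. -/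
theorem swapEq_of_growN (hcf : N.ConflictFree) (n : ℕ) {P₀ Q₀ P Q : TokProc N}
    (hP₀ : Finite P₀.T) (hQ₀ : Finite Q₀.T) (h₀ : N.Leads 0 P₀.parikh)
    (hp : P₀.parikh = Q₀.parikh) (h : SwapEq P₀ Q₀) (hP : GrowN n P₀ P) (hQ : GrowN n Q₀ Q)
    (hPQ : P.parikh = Q.parikh) : SwapEq P Q := by
  induction n generalizing P₀ Q₀ P Q with
  | zero =>
    obtain ⟨i⟩ := hP
    obtain ⟨j⟩ := hQ
    exact ((SwapEq.of_iso i.symm).trans h).trans (SwapEq.of_iso j)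
  | succ n ih =>
    obtain ⟨t, R, hPR, hR⟩ := id hP
    obtain ⟨u, R', hQR, hR'⟩ := id hQ
    have hRf := hPR.finite hP₀
    have hRf' := hQR.finite hQ₀
    have et := hPR.enabled hP₀
    have eu := hQR.enabled hQ₀
    have pt := hPR.parikh hP₀
    have pu := hQR.parikh hQ₀
    rw [← hp] at eu pu
    have lt : N.Leads 0 R.parikh := h₀.tail ⟨t, et, pt⟩
    by_cases htu : t = u
    · subst htu
      exact ih hRf hRf' lt (pt.trans pu.symm) (swapEq_of_grow h hPR hQR) hR hR' hPQ
    · obtain ⟨A, B, hA, hB, hAB⟩ := P₀.exists_disjoint_addable (hcf.pair_le h₀ et eu htu)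
      have g1 := Grow.of_add hA
      have g2 := Grow.of_add (hA.add hB hAB)
      have g3 := Grow.of_add hB
      have g4 : Grow t (P₀.add u B hB) ((P₀.add t A hA).add u _ (hA.add hB hAB)) :=
        ⟨_, hB.add hA hAB.symm, (add_add_iso hA hB hAB).map Iso.symm⟩
      have f1 := g1.finite hP₀
      have f2 := g2.finite f1
      have f3 := g3.finite hP₀
      have p1 := g1.parikh hP₀
      have p3 := g3.parikh hP₀
      have p2 := g2.parikh f1
      rw [p1] at p2
      have l1 : N.Leads 0 (P₀.add t A hA).parikh := h₀.tail ⟨t, et, p1⟩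
      have l3 : N.Leads 0 (P₀.add u B hB).parikh := h₀.tail ⟨u, eu, p3⟩
      have l2 : N.Leads 0 ((P₀.add t A hA).add u _ (hA.add hB hAB)).parikh :=
        l1.tail ⟨u, g2.enabled f1, by rw [p2, p1]⟩
      have lz : N.Leads 0 P.parikh := h₀.trans (hP.leads hP₀)
      -- The vector of `P = Q` exceeds that of `P₀` by at least one `t` and at least one `u`, and `t
      -- ≠ u`.
      have le : ((P₀.add t A hA).add u _ (hA.add hB hAB)).parikh ≤ P.parikh := by
        classical
        have q1 := (hR.leads hRf).le
        have q2 := (hR'.leads hRf').le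
        rw [pt] at q1
        rw [pu, ← hPQ] at q2
        rw [p2]
        intro v
        have r1 := q1 v
        have r2 := q2 v
        simp only [Finsupp.add_apply, Finsupp.single_apply] at *
        by_cases hv : t = v
        · subst hv
          simpa [Ne.symm htu] using r1
        · simpa [hv] using r2
      obtain ⟨m, P₃, hm, hz⟩ := exists_growN_of_leads f2 (hcf.leads_of_le l2 lz le)
      -- Beyond `P₀` there are `n + 1` transitions in `P` and `m + 2` in `P₃`.
      obtain rfl : n = m + 1 := by
        have d1 := hP.degree hP₀
        have d2 := hm.degree f2
        rw [hz, d1, p2, map_add, map_add, Finsupp.degree_single, Finsupp.degree_single] at d2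
        omega
      have s1 : SwapEq P P₃ := ih hRf f1 lt (pt.trans p1.symm) (swapEq_of_grow .refl hPR g1) hR
        ⟨u, _, g2, hm⟩ hz.symm
      have s2 : SwapEq P₃ Q := ih f3 hRf' l3 (p3.trans pu.symm) (swapEq_of_grow h g3 hQR)
        ⟨t, _, g4, hm⟩ hR' (hz.trans hPQ)
      exact s1.trans s2

/-- A causally minimal element of `E \ E₀` has all its predecessors in `E₀`, so it can be added
next. -/
theorem growN_restrict (P : TokProc N) {E₀ E : Set P.T} (h₀ : P.Closed E₀) (h : P.Closed E)
    (hE : E.Finite) (hs : E₀ ⊆ E) :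
    GrowN (E \ E₀).ncard (P.restrict E₀ h₀) (P.restrict E h) := by
  induction hn : (E \ E₀).ncard generalizing E₀ with
  | zero =>
    rw [Set.ncard_eq_zero (hE.subset Set.sdiff_subset), Set.sdiff_eq_empty] at hn
    obtain rfl := hs.antisymm hn
    exact ⟨.refl _⟩
  | succ n ih =>
    have hne : (E \ E₀).Nonempty := by
      rw [← Set.ncard_pos (hE.subset Set.sdiff_subset)]; omega
    obtain ⟨e, he, hmin⟩ := P.elt_wf.has_min _ hne
    have hpre : ∀ t, P.elt t e → t ∈ E₀ := fun t ht => by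
      by_contra h'
      exact hmin t ⟨h t e ht he.1, h'⟩ ht
    have h₁ := h₀.insert hpre
    refine ⟨P.πT e, P.restrict _ h₁, ⟨_, P.addable_restrict h₀ he.2 hpre,
      P.restrict_insert h₀ he.2 hpre h₁⟩, ih h₁ (Set.insert_subset he.1 hs) ?_⟩
    have : E \ insert e E₀ = (E \ E₀) \ {e} := by
      ext x; simp only [Set.mem_sdiff, Set.mem_insert_iff, Set.mem_singleton_iff]; tauto
    rw [this, Set.ncard_sdiff_singleton_of_mem he, hn]
    rfl

theorem closed_empty (P : TokProc N) : P.Closed ∅ := fun _ _ _ h => h.elim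

theorem closed_univ (P : TokProc N) : P.Closed Set.univ := fun _ _ _ _ => trivial

theorem parikh_restrict_empty (P : TokProc N) : (P.restrict ∅ P.closed_empty).parikh = 0 := by
  have : IsEmpty (P.restrict ∅ P.closed_empty).T := inferInstanceAs (IsEmpty (∅ : Set P.T))
  exact finsum_of_isEmpty _

theorem exists_growN (P : TokProc N) [Finite P.T] :
    ∃ n, GrowN n (P.restrict ∅ P.closed_empty) P :=
  ⟨_, (P.growN_restrict P.closed_empty P.closed_univ Set.finite_univ (Set.empty_subset _)).trans_iso
    (P.restrictUniv _)⟩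

/-- Without transitions all places are initial, and each label `x` has exactly `N.M₀ x` of them. -/
theorem nonempty_iso_of_isEmpty (P Q : TokProc N) (hP : IsEmpty P.T) (hQ : IsEmpty Q.T) :
    Nonempty (Iso P Q) := by
  have key : ∀ (R : TokProc N), IsEmpty R.T → (∀ s, R.prod s = none) ∧ (∀ s, R.cons s = none) :=
    fun R hR => ⟨fun s => Option.eq_none_iff_forall_ne_some.2 fun t => hR.elim t,
      fun s => Option.eq_none_iff_forall_ne_some.2 fun t => hR.elim t⟩
  have h1 := key P hP
  have h2 := key Q hQ
  obtain ⟨e, he⟩ := exists_equiv_of_encard_fiber_eq (f := P.πS) (g := Q.πS) (c := N.M₀)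
    (fun x => by simpa [h1.1] using P.init_card x) (fun x => by simpa [h2.1] using Q.init_card x)
  exact ⟨⟨e, Equiv.equivOfIsEmpty _ _, fun s => by simp [h1.1, h2.1],
    fun s => by simp [h1.2, h2.2], he, fun t => hP.elim t⟩⟩

theorem leads_parikh (P : TokProc N) [Finite P.T] : N.Leads 0 P.parikh := by
  obtain ⟨n, hn⟩ := P.exists_growN
  have := hn.leads (inferInstanceAs (Finite (∅ : Set P.T)))
  rwa [parikh_restrict_empty] at this

/-- In a conflict-free net, finite processes with equally many occurrences of each transition
are equal up to swapping. -/
theorem swapEq_of_parikh_eq (hcf : N.ConflictFree) (P Q : TokProc N) [Finite P.T] [Finite Q.T]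
    (h : P.parikh = Q.parikh) : SwapEq P Q := by
  obtain ⟨n, hn⟩ := P.exists_growN
  obtain ⟨m, hm⟩ := Q.exists_growN
  have fP : Finite (P.restrict ∅ P.closed_empty).T := inferInstanceAs (Finite (∅ : Set P.T))
  have fQ : Finite (Q.restrict ∅ Q.closed_empty).T := inferInstanceAs (Finite (∅ : Set Q.T))
  obtain rfl : n = m := by
    have d1 := hn.degree fP
    have d2 := hm.degree fQ
    rw [parikh_restrict_empty, map_zero] at d1 d2
    rw [h] at d1
    omega
  obtain ⟨i⟩ := nonempty_iso_of_isEmpty (P.restrict ∅ P.closed_empty) (Q.restrict ∅ Q.closed_empty)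
    (inferInstanceAs (IsEmpty (∅ : Set P.T))) (inferInstanceAs (IsEmpty (∅ : Set Q.T)))
  refine swapEq_of_growN hcf n fP fQ ?_ i.parikh (.of_iso i) hn hm h
  rw [parikh_restrict_empty]
  exact .refl

end TokProc

/-! ### Stuck processes contain every reachable Parikh vector -/

namespace TokProc
variable {N : PTNet.{u}}

theorem parikhOn_mono (P : TokProc N) {E F : Finset P.T} (h : E ⊆ F) :
    P.parikhOn E ≤ P.parikhOn F := by
  classical
  unfold parikhOn
  rw [← Finset.sum_sdiff h]
  exact le_add_self

theorem parikhOn_insert (P : TokProc N) [DecidableEq P.T] {E : Finset P.T} {e : P.T} (h : e ∉ E) :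
    P.parikhOn (insert e E) = P.parikhOn E + Finsupp.single (P.πT e) 1 := by
  unfold parikhOn
  rw [Finset.sum_insert h, add_comm]

theorem parikhOn_apply_eq (P : TokProc N) {E F : Finset P.T} (h : E ⊆ F) {t : N.T}
    (ht : ∀ e, P.πT e = t → e ∈ E) : P.parikhOn F t = P.parikhOn E t := by
  classical
  unfold parikhOn
  rw [Finsupp.finsetSum_apply, Finsupp.finsetSum_apply]
  refine (Finset.sum_subset h fun e _ he => ?_).symm
  rw [Finsupp.single_apply, if_neg fun h => he (ht e h)]

theorem closed_past (P : TokProc N) (e : P.T) : P.Closed {t | Relation.TransGen P.elt t e} :=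
  fun _ _ htu hu => .head htu hu

theorem exists_closed_superset (P : TokProc N) (E : Finset P.T) :
    ∃ F : Finset P.T, E ⊆ F ∧ P.Closed (F : Set P.T) := by
  classical
  induction E using Finset.induction_on with
  | empty => exact ⟨∅, Finset.Subset.refl _, by simpa using P.closed_empty⟩
  | insert e E _ ih =>
    obtain ⟨F, hEF, hF⟩ := ih
    refine ⟨insert e (F ∪ (P.past_finite e).toFinset), ?_, ?_⟩
    · exact Finset.insert_subset_insert _ (hEF.trans Finset.subset_union_left)
    · intro t u htu hu
      simp only [Finset.coe_insert, Finset.coe_union, Set.Finite.coe_toFinset,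
        Set.mem_insert_iff, Set.mem_union, Finset.mem_coe, Set.mem_ofPred_eq] at hu ⊢
      rcases hu with rfl | hu | hu
      · exact Or.inr (Or.inr (.single htu))
      · exact Or.inr (Or.inl (hF t u htu hu))
      · exact Or.inr (Or.inr (.head htu hu))

theorem leads_parikhOn (P : TokProc N) {E : Finset P.T} (hE : P.Closed (E : Set P.T)) :
    N.Leads 0 (P.parikhOn E) := by
  have : Finite (P.restrict _ hE).T := E.finite_toSet
  rw [← P.parikh_restrict E hE]
  exact leads_parikh _

theorem enabled_parikhOn (P : TokProc N) {E : Finset P.T} (hE : P.Closed (E : Set P.T)) {e : P.T}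
    (he : e ∉ E) (hpre : ∀ t, P.elt t e → t ∈ E) : N.Enabled (P.parikhOn E) (P.πT e) := by
  have : Finite (P.restrict _ hE).T := E.finite_toSet
  rw [← P.parikh_restrict E hE, ← exists_addable_iff_enabled]
  exact ⟨_, P.addable_restrict hE he hpre⟩

/-- No transition can be added to `P`. -/
def Stuck (P : TokProc N) : Prop := ∀ t A, ¬ P.Addable t A

theorem stuck_of_isMaximal {P : TokProc N} (h : P.toGR.IsMaximal) : P.Stuck := by
  intro t A hA
  obtain ⟨i, -, hi⟩ := P.exists_prefixIncl_add hA
  have := (h _ i).2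
  rw [hi] at this
  obtain ⟨e, he⟩ := this (none : Option P.T)
  cases he

/-- Suppose `e ∉ E` and add the past of `e` to `E`. This brings in no new `t`, so `t` is still
enabled, and so is the label of `e`, which differs from `t`. By conflict-freeness the two can fire
in one step; the structural condition then forbids their common preplace, the label of `s`. -/
theorem not_consumed_of_enabled (hcf : N.ConflictFree) (hsc : N.StructuralConflictNet)
    (P : TokProc N) {E : Finset P.T} (hE : P.Closed (E : Set P.T)) {t : N.T}
    (ht : N.Enabled (P.parikhOn E) t) (htE : ∀ e, P.πT e = t → e ∈ E) {s : P.S}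
    (hs : 0 < N.pre t (P.πS s)) {e : P.T} (he : P.cons s = some e) : e ∈ E := by
  classical
  by_contra heE
  let F := E ∪ (P.past_finite e).toFinset
  have hF : P.Closed (F : Set P.T) := by
    intro a b hab hb
    simp only [F, Finset.coe_union, Set.Finite.coe_toFinset, Set.mem_union] at hb ⊢
    exact hb.imp (hE a b hab) (P.closed_past e a b hab)
  have heF : e ∉ F := by
    simp only [F, Finset.mem_union, Set.Finite.mem_toFinset, heE, false_or]
    exact P.elt_wf.transGen.irrefl.irrefl e
  have hpre : ∀ a, P.elt a e → a ∈ F := fun a ha => by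
    simp only [F, Finset.mem_union, Set.Finite.mem_toFinset]
    exact Or.inr (.single ha)
  have hEF : E ⊆ F := Finset.subset_union_left
  have lE := P.leads_parikhOn hE
  have lF := P.leads_parikhOn hF
  have htF : N.Enabled (P.parikhOn F) t := hcf.enabled_of_leads lE
    (hcf.leads_of_le lE lF (P.parikhOn_mono hEF)) ht (P.parikhOn_apply_eq hEF htE)
  have heF' := P.enabled_parikhOn hF heF hpre
  have hne : t ≠ P.πT e := fun h => heE (htE e h.symm)
  have hmin := hsc t (P.πT e) _ (PTNet.reachable_of_leads lF).2
    (hcf.canStep_pair lF htF heF' hne) (P.πS s)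
  have hpos : 0 < N.pre (P.πT e) (P.πS s) := by
    rw [Nat.pos_iff_ne_zero]
    intro h0
    have := P.pre_card e (P.πS s)
    rw [h0, Nat.cast_zero, Set.encard_eq_zero] at this
    exact this.le ⟨he, rfl⟩
  omega

theorem Stuck.covers (hcf : N.ConflictFree) (hsc : N.StructuralConflictNet) {P : TokProc N}
    (hP : P.Stuck) {y : N.T →₀ ℕ} (hy : N.Leads 0 y) :
    ∃ E : Finset P.T, P.Closed (E : Set P.T) ∧ y ≤ P.parikhOn E := by
  classical
  induction hy with
  | refl => exact ⟨∅, by simpa using P.closed_empty, zero_le⟩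
  | @tail y z hy hyz ih =>
    obtain ⟨t, ht, rfl⟩ := hyz
    obtain ⟨E, hE, hyE⟩ := ih
    by_cases htE : ∀ e, P.πT e = t → e ∈ E
    swap
    -- An occurrence of `t` outside `E` supplies the required one, once its past is added too.
    · push Not at htE
      obtain ⟨e, rfl, he⟩ := htE
      obtain ⟨F, hEF, hF⟩ := P.exists_closed_superset (insert e E)
      refine ⟨F, hF, le_trans ?_ (P.parikhOn_mono hEF)⟩
      rw [P.parikhOn_insert he]
      exact add_le_add_left hyE _
    have lE := P.leads_parikhOn hE
    refine ⟨E, hE, ?_⟩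
    -- Here all occurrences of `t` lie in `E`. If there are more than `y t` of them, `E` suffices as
    -- it is.
    by_cases hlt : y t < P.parikhOn E t
    · intro v
      by_cases hv : t = v
      · subst hv
        simpa using hlt
      · simpa [hv] using hyE v
    exfalso
    -- Otherwise `t` does not fire between `y` and the vector of `E`, so it is still enabled after
    -- `E`.
    have htE' : N.Enabled (P.parikhOn E) t := hcf.enabled_of_leads hy
      (hcf.leads_of_le hy lE hyE) ht (le_antisymm (not_lt.1 hlt) (hyE t))
    have hfin : Finite (P.restrict _ hE).T := E.finite_toSet
    have hle := htE'
    rw [← P.parikh_restrict E hE, ← pre_le_iff_enabled] at hle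
    -- Tokens on preplaces of `t` that `E` leaves unconsumed are unconsumed in all of `P`, so `t`
    -- can be added to `P` itself.
    obtain ⟨A, -, hA⟩ := P.exists_addable_subset (t := t) {s | P.cons s = none} (fun s hs => hs)
      (fun x => by
        rcases Nat.eq_zero_or_pos (N.pre t x) with h0 | hpos
        · simp [h0]
        refine (hle x).trans ?_
        rw [← Subtype.val_injective.encard_image]
        refine Set.encard_le_encard ?_
        rintro _ ⟨s, ⟨hs, rfl⟩, rfl⟩
        refine ⟨?_, rfl⟩
        change P.cons s.1 = none
        rw [Option.eq_none_iff_forall_ne_some]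
        intro e he
        exact clip_eq_none.1 hs e
          (not_consumed_of_enabled hcf hsc P hE htE' htE hpos he) he)
    exact hP t A hA

end TokProc

/-! ### Covering, and the swapping preorder -/

/-- Finitely many transitions of `P` comprise, with multiplicity, those in `y`. -/
def LabelledNet.Covers {N : PTNet.{u}} (P : LabelledNet N) (y : N.T →₀ ℕ) : Prop :=
  ∃ E : Finset P.net.T, y ≤ ∑ e ∈ E, Finsupp.single (P.πT e) 1

theorem LabelledNet.Covers.map {N : PTNet.{u}} {P Q : LabelledNet N} {y : N.T →₀ ℕ}
    (h : P.Covers y) (f : P.net.T ↪ Q.net.T) (hf : ∀ t, Q.πT (f t) = P.πT t) : Q.Covers y := by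
  obtain ⟨E, hE⟩ := h
  refine ⟨E.map f, ?_⟩
  rw [Finset.sum_map]
  simpa only [hf] using hE

namespace GRProcess
variable {N : PTNet.{u}}

theorem SwapStar.covers {P Q : GRProcess N} (h : SwapStar P Q) {y : N.T →₀ ℕ}
    (hy : P.1.Covers y) : Q.1.Covers y := by
  induction h with
  | refl => exact hy
  | tail _ h ih =>
    obtain ⟨_, _, _, _, _, ⟨i⟩⟩ := h
    exact ih.map i.φT.toEmbedding i.map_πT

/-- Swaps and isomorphisms preserve the labelled transitions, though not the causal order. So a set
of transitions can be transported along them, without any claim that the image is downward closed.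
-/
theorem SwapInftyHalf.covers {P : TokProc N} {Q : GRProcess N} (h : SwapInftyHalf P.toGR Q)
    {y : N.T →₀ ℕ} {E : Finset P.T} (hE : P.Closed (E : Set P.T)) (hy : y ≤ P.parikhOn E) :
    Q.1.Covers y := by
  obtain ⟨Q', Q'', hQ', ⟨i⟩, ⟨j⟩⟩ := h (P.restrict _ hE).toGR E.finite_toSet (P.prefix_restrict _ hE)
  refine hQ'.covers (.map (.map (P := (P.restrict _ hE).toLabelled) ?_ j.φT.toEmbedding j.map_πT)
    i.iT i.πT)
  have : Fintype (P.restrict _ hE).T := Fintype.ofFinite _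
  refine ⟨Finset.univ (α := (P.restrict _ hE).T), hy.trans ?_⟩
  rw [← P.parikh_restrict E hE, TokProc.parikh_eq]
  exact le_rfl

/-- The covering transitions, closed under pasts, give a finite prefix of `Q` whose vector dominates
that of the given finite process. The latter is grown to this vector, after which equality of
vectors gives the swaps. -/
theorem swapLe_of_covers (hcf : N.ConflictFree) {Q : GRProcess N}
    (hQ : ∀ y, N.Leads 0 y → Q.1.Covers y) (R : GRProcess N) : SwapLe R Q := by
  intro P hP _
  obtain ⟨P, rfl⟩ := TokProc.exists_toGR_eq P
  obtain ⟨Q, rfl⟩ := TokProc.exists_toGR_eq Q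
  have hP : Finite P.T := hP
  obtain ⟨E, hE⟩ := hQ _ P.leads_parikh
  obtain ⟨F, hEF, hF⟩ := Q.exists_closed_superset E
  have hfin : Finite (Q.restrict _ hF).T := F.finite_toSet
  have hle : P.parikh ≤ (Q.restrict _ hF).parikh := by
    rw [TokProc.parikh_restrict]
    exact le_trans hE (Q.parikhOn_mono hEF)
  obtain ⟨n, P', hn, hP'⟩ := TokProc.exists_growN_of_leads hP
    (hcf.leads_of_le P.leads_parikh (TokProc.leads_parikh _) hle)
  have hfin' := hn.finite hP
  -- If only an isomorphism is available, the prefix of `Q` itself serves as the extension.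
  rcases (TokProc.swapEq_of_parikh_eq hcf _ _ hP').toGR with h | ⟨⟨i⟩⟩
  · exact ⟨P'.toGR, (Q.restrict _ hF).toGR, hfin', hfin, hn.prefix, h, Q.prefix_restrict _ hF⟩
  · exact ⟨(Q.restrict _ hF).toGR, (Q.restrict _ hF).toGR, hfin, hfin, hn.prefix.trans i.prefix, .refl, Q.prefix_restrict _ hF⟩

end GRProcess

theorem TokProc.Stuck.isLargest {N : PTNet.{u}} (hcf : N.ConflictFree)
    (hsc : N.StructuralConflictNet) {P : TokProc N} (hP : P.Stuck) : P.toGR.toBD.IsLargest := by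
  intro C R _ Q hQ
  refine GRProcess.swapLe_of_covers hcf (fun y hy => ?_) R
  obtain ⟨E, hE, hyE⟩ := hP.covers hcf hsc hy
  exact GRProcess.SwapInftyHalf.covers (hQ : GRProcess.SwapInfty Q P.toGR).2 hE hyE

/-! ### Existence of a stuck process in the unfolding -/

/-- Names for the transitions of the unfolding of a net.  A token is named by the transition that
produces it (`root` for an initial token), its place and a number. -/
inductive UnfoldingEvent (N : PTNet.{u}) : Type u
  | root : UnfoldingEvent N
  | fire (t : N.T) (k : ℕ) (src : Fin k → UnfoldingEvent N) (pl : Fin k → N.S)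
      (idx : Fin k → ℕ) : UnfoldingEvent N

namespace UnfoldingEvent
variable {N : PTNet.{u}}

def label : (e : UnfoldingEvent N) → e ≠ root → N.T
  | root, h => (h rfl).elim
  | fire t _ _ _ _, _ => t

def numIn : UnfoldingEvent N → N.S → ℕ
  | root => 0
  | fire t _ _ _ _ => N.pre t

def numOut : UnfoldingEvent N → N.S → ℕ
  | root => N.M₀
  | fire t _ _ _ _ => N.post t

def preset : UnfoldingEvent N → Set (UnfoldingEvent N × N.S × ℕ)
  | root => ∅
  | fire _ _ src pl idx => Set.range fun j => (src j, pl j, idx j)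

theorem numIn_eq {e : UnfoldingEvent N} (h : e ≠ root) : e.numIn = N.pre (e.label h) := by
  cases e
  · exact (h rfl).elim
  · rfl

theorem numOut_eq {e : UnfoldingEvent N} (h : e ≠ root) : e.numOut = N.post (e.label h) := by
  cases e
  · exact (h rfl).elim
  · rfl

theorem wf_mem_preset :
    WellFounded fun e f : UnfoldingEvent N => ∃ c ∈ f.preset, c.1 = e := by
  refine ⟨fun f => ?_⟩
  induction f with
  | root =>
    refine ⟨_, ?_⟩
    rintro e ⟨c, hc, -⟩
    exact hc.elim
  | fire t k src pl idx ih =>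
    refine ⟨_, ?_⟩
    rintro e ⟨c, ⟨j, rfl⟩, rfl⟩
    exact ih j

/-- `c` is a token that is initial or produced by a transition in `E`. -/
def IsToken (E : Set (UnfoldingEvent N)) (c : UnfoldingEvent N × N.S × ℕ) : Prop :=
  (c.1 = root ∨ c.1 ∈ E) ∧ c.2.2 < c.1.numOut c.2.1

theorem IsToken.mono {E F : Set (UnfoldingEvent N)} (h : E ⊆ F)
    {c : UnfoldingEvent N × N.S × ℕ} (hc : IsToken E c) : IsToken F c :=
  ⟨hc.1.imp_right fun h' => h h', hc.2⟩

/-- The sets of transitions of the unfolding that form a process. -/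
structure IsConfig (E : Set (UnfoldingEvent N)) : Prop where
  root_notMem : root ∉ E
  isToken : ∀ e ∈ E, ∀ c ∈ e.preset, IsToken E c
  card : ∀ e ∈ E, ∀ x, {c | c ∈ e.preset ∧ c.2.1 = x}.encard = (e.numIn x : ℕ∞)
  eq_of_mem : ∀ e ∈ E, ∀ f ∈ E, ∀ c ∈ e.preset, c ∈ f.preset → e = f

theorem IsConfig.ne_root {E : Set (UnfoldingEvent N)} (hE : IsConfig E) (e : E) : e.1 ≠ root :=
  fun h => hE.root_notMem (h ▸ e.2)

theorem encard_tokens {E : Set (UnfoldingEvent N)} {e : UnfoldingEvent N}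
    (he : e = root ∨ e ∈ E) (x : N.S) :
    {c : {c // IsToken E c} | c.1.1 = e ∧ c.1.2.1 = x}.encard = (e.numOut x : ℕ∞) := by
  rw [← Subtype.val_injective.encard_image]
  have : Subtype.val '' {c : {c // IsToken E c} | c.1.1 = e ∧ c.1.2.1 = x} =
      (fun i : ℕ => (e, x, i)) '' (Finset.range (e.numOut x) : Set ℕ) := by
    ext c
    constructor
    · rintro ⟨⟨⟨_, _, i⟩, hc⟩, ⟨rfl, rfl⟩, rfl⟩
      exact ⟨i, by simpa using hc.2, rfl⟩
    · rintro ⟨i, hi, rfl⟩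
      exact ⟨⟨(e, x, i), he, by simpa using hi⟩, ⟨rfl, rfl⟩, rfl⟩
  rw [this, Function.Injective.encard_image (fun i j h => by simpa using h),
    Set.encard_coe_eq_coe_finsetCard, Finset.card_range]

open Classical in
/-- The transition in `E` that consumes `c`. -/
noncomputable def consumer (E : Set (UnfoldingEvent N)) (c : UnfoldingEvent N × N.S × ℕ) :
    Option E :=
  if h : ∃ e : E, c ∈ e.1.preset then some h.choose else none

theorem IsConfig.consumer_eq_some {E : Set (UnfoldingEvent N)} (hE : IsConfig E)
    {c : UnfoldingEvent N × N.S × ℕ} {e : E} : consumer E c = some e ↔ c ∈ e.1.preset := by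
  unfold consumer
  by_cases h : ∃ e : E, c ∈ e.1.preset
  · simp only [h, dite_true, Option.some.injEq]
    constructor
    · rintro rfl
      exact h.choose_spec
    · intro he
      exact Subtype.ext (hE.eq_of_mem _ h.choose.2 _ e.2 _ h.choose_spec he)
  · simp only [h, dite_false, reduceCtorEq, false_iff]
    exact fun he => h ⟨e, he⟩

/-- The process with the set `E` of transitions. -/
noncomputable abbrev IsConfig.toTokProc {E : Set (UnfoldingEvent N)} (hE : IsConfig E) :
    TokProc N where
  S := {c // IsToken E c}
  T := E
  prod c := TokProc.clip E (some c.1.1)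
  cons c := consumer E c.1
  πS c := c.1.2.1
  πT e := e.1.label (hE.ne_root e)
  init_card x := by
    rw [← show (root : UnfoldingEvent N).numOut x = N.M₀ x from rfl,
      ← encard_tokens (E := E) (Or.inl rfl) x]
    congr 1
    ext c
    refine and_congr_left fun _ => ?_
    rw [TokProc.clip_eq_none]
    constructor
    · intro h
      exact c.2.1.resolve_right fun hc => h _ hc rfl
    · intro h e he h'
      cases h'
      exact hE.root_notMem (h ▸ he)
  pre_card e x := by
    rw [← numIn_eq, ← hE.card e.1 e.2 x, ← TokProc.encard_subtype_and (p := IsToken E)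
      fun c hc => hE.isToken e.1 e.2 c hc.1]
    congr 1
    ext c
    refine and_congr_left fun _ => hE.consumer_eq_some
  post_card e x := by
    rw [← numOut_eq, ← encard_tokens (E := E) (Or.inr e.2) x]
    congr 1
    ext c
    refine and_congr_left fun _ => ?_
    rw [TokProc.clip_eq_some, Option.some.injEq]
  wf := by
    refine Subrelation.wf ?_ (InvImage.wf (fun c : {c // IsToken E c} => c.1.1) wf_mem_preset)
    rintro a b ⟨e, ha, hb⟩
    rw [TokProc.clip_eq_some, Option.some.injEq] at hb
    refine ⟨a.1, ?_, rfl⟩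
    change a.1 ∈ b.1.1.preset
    rw [hb]
    exact hE.consumer_eq_some.1 ha

/-- Configurations are subsets of one fixed type, so chains have unions. Each condition concerns at
most two given transitions, and these lie in a common member of the chain. -/
theorem isConfig_sUnion {C : Set (Set (UnfoldingEvent N))} (hC : ∀ E ∈ C, IsConfig E)
    (hchain : IsChain (· ⊆ ·) C) : IsConfig (⋃₀ C) where
  root_notMem := by
    rintro ⟨E, hE, h⟩
    exact (hC E hE).root_notMem h
  isToken := by
    rintro e ⟨E, hE, he⟩ c hc
    exact ((hC E hE).isToken e he c hc).mono (Set.subset_sUnion_of_mem hE)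
  card := by
    rintro e ⟨E, hE, he⟩ x
    exact (hC E hE).card e he x
  eq_of_mem := by
    rintro e ⟨E, hE, he⟩ f ⟨F, hF, hf⟩ c hce hcf
    rcases hchain.total hE hF with h | h
    · exact (hC F hF).eq_of_mem e (h he) f hf c hce hcf
    · exact (hC E hE).eq_of_mem e he f (h hf) c hce hcf

theorem stuck_of_maximal {E : Set (UnfoldingEvent N)} (hE : IsConfig E)
    (hmax : ∀ F, IsConfig F → E ⊆ F → F ⊆ E) : hE.toTokProc.Stuck := by
  intro t A hA
  -- An event stores its preset as a finite sequence. Any enumeration of `A` will do: two names with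
  -- the same non-empty preset never occur together, by `IsConfig.eq_of_mem`.
  obtain ⟨k, f, hf⟩ := hA.finite.fin_embedding
  let e : UnfoldingEvent N :=
    .fire t k (fun j => (f j).1.1) (fun j => (f j).1.2.1) (fun j => (f j).1.2.2)
  have hpre : e.preset = Subtype.val '' A := by
    rw [← hf, ← Set.range_comp]
    rfl
  have hfree : ∀ s ∈ A, ∀ g ∈ E, s.1 ∉ g.preset := by
    intro s hs g hg h
    have h1 := hE.consumer_eq_some.2 (show s.1 ∈ (⟨g, hg⟩ : E).1.preset from h)
    have h2 : consumer E s.1 = none := hA.cons_eq_none s hs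
    rw [h2] at h1
    cases h1
  have hins : IsConfig (insert e E) := by
    refine ⟨?_, ?_, ?_, ?_⟩
    · rintro (h | h)
      · simp [e] at h
      · exact hE.root_notMem h
    · rintro g (rfl | hg) c hc
      · rw [hpre] at hc
        obtain ⟨s, -, rfl⟩ := hc
        exact s.2.mono (Set.subset_insert _ _)
      · exact (hE.isToken g hg c hc).mono (Set.subset_insert _ _)
    · rintro g (rfl | hg) x
      · rw [hpre, show e.numIn x = N.pre t x from rfl, ← hA.card x,
          ← Subtype.val_injective.encard_image]
        congr 1
        ext c
        constructor
        · rintro ⟨⟨s, hs, rfl⟩, hx⟩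
          exact ⟨s, ⟨hs, hx⟩, rfl⟩
        · rintro ⟨s, ⟨hs, hx⟩, rfl⟩
          exact ⟨⟨s, hs, rfl⟩, hx⟩
      · exact hE.card g hg x
    · rintro g (rfl | hg) g' (rfl | hg') c hc hc'
      · rfl
      · rw [hpre] at hc
        obtain ⟨s, hs, rfl⟩ := hc
        exact (hfree s hs g' hg' hc').elim
      · rw [hpre] at hc'
        obtain ⟨s, hs, rfl⟩ := hc'
        exact (hfree s hs g hg hc).elim
      · exact hE.eq_of_mem g hg g' hg' c hc hc'
  have heE : e ∈ E := hmax _ hins (Set.subset_insert _ _) (Set.mem_insert _ _)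
  -- As `t` has a preplace, `A` is non-empty, so `e ∈ E` would consume a token that is unconsumed in
  -- `E`.
  obtain ⟨x, hx⟩ := N.pre_nonempty t
  obtain ⟨s, hs, -⟩ : {s | s ∈ A ∧ hE.toTokProc.πS s = x}.Nonempty := by
    rw [← Set.encard_ne_zero, hA.card x]
    simpa using (show 0 < N.pre t x from hx).ne'
  exact hfree s hs e heE (hpre ▸ ⟨s, hs, rfl⟩)

end UnfoldingEvent

theorem TokProc.exists_stuck (N : PTNet.{u}) : ∃ P : TokProc N, P.Stuck := by
  obtain ⟨E, hE⟩ := zorn_subset {E : Set (UnfoldingEvent N) | UnfoldingEvent.IsConfig E}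
    fun C hC hchain => ⟨⋃₀ C, UnfoldingEvent.isConfig_sUnion hC hchain,
      fun _ h => Set.subset_sUnion_of_mem h⟩
  exact ⟨_, UnfoldingEvent.stuck_of_maximal hE.1 fun F hF h => hE.2 hF h⟩

theorem mainTheorem1 (N : PTNet.{u}) (hcf : N.ConflictFree) (hsc : N.StructuralConflictNet) :
    (∃ B : BDProcess N, B.IsLargest) ∧
      ∀ P : GRProcess N, P.IsMaximal → P.toBD.IsLargest := by
  refine ⟨?_, fun P hP => ?_⟩
  · obtain ⟨P, hP⟩ := TokProc.exists_stuck N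
    exact ⟨_, hP.isLargest hcf hsc⟩
  · obtain ⟨P, rfl⟩ := TokProc.exists_toGR_eq P
    exact (TokProc.stuck_of_isMaximal hP).isLargest hcf hsc
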